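/- **Setting.** An instance of $k$-cover consists of a finite ground set $\mathcal E$ of $m\ge 2$ elements and a family $\mathcal F$ of $n$ subsets of $\mathcal E$ such that every element lies in at least one set. The degree $\deg(v)$ of an element $v$ is the number of sets of $\mathcal F$ containing it, and its edges are the pairs $(S,v)$ with $v\in S\in\mathcal F$. For $\mathcal S\subseteq\mathcal F$ let $\mathcal C(\mathcal S)=|\bigcup_{S\in\mathcal S}S|$. For $1\le k\le n$, an $\alpha$-approximate solution to $k$-cover is a subfamily $\mathcal S$ with $|\mathcal S|=k$ and $\mathcal C(\mathcal S)\ge\alpha\,\mathcal C(\mathcal S')$ for all $\mathcal S'\subseteq\mathcal F$ with $|\mathcal S'|=k$. **Algorithm.** The parameters are $k$, $\varepsilon'\in(0,1)$ and $\delta''$. Put $$\delta=\delta''\log\log_{1/(1-\varepsilon')}m,\qquad \tilde n=\frac{24\,n\,\delta\,\log(1/\varepsilon')\log n}{(1-\varepsilon')\varepsilon'^3},\qquad \Delta=\Big\lfloor\frac{n\log(1/\varepsilon')}{\varepsilon' k}\Big\rfloor .$$ There are a machine one and a distinct machine for each element $v$, which holds the edges of $v$ and a hash value $h(v)$; the values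 $h(v)$, $v\in\mathcal E$, are independent and uniform on $[0,1]$. In each round every machine receives the messages sent to it in the previous round, computes, and sends messages. * Round 1. If $h(v)\le 2\tilde n/m$, the machine of $v$ sends $h(v)$ and $\deg(v)$ to machine one. * Round 2. Machine one repeatedly selects a remaining reported element with smallest $h$, until the sum of $\min(\deg(v),\Delta)$ over the selected elements reaches $\tilde n$ or all reported elements are selected. It informs the machines of the selected elements. * Round 3. The machine of each selected element $v$ sends arbitrary $\min(\deg(v),\Delta)$ edges of $v$ to machine one. * Round 4. Machine one runs the greedy algorithm on the graph it has received: starting from no set, it $k$ times adds a set that maximizes the number of elements covered in this graph. The chosen $k$ sets are the output. Space is counted in words; the name of a set or of an element, a degree, a hash value, a counter and the address of a message take one word each. The space of a machine is the largest number of words it has in memory (stored input, received messages, outgoing messages and working data) at the beginning or end of a round or between two consecutive steps of its local computation in a round. A step is a single selection in Round 2, a single greedy choice in Round 4, and the preparation of a machine's messages in Rounds 1 and 3. **Theorem.** There are absolute constants $0<a<1$, $b>0$ and $K>0$ such that the following holds for every instance as above, every $1\le k\le n$ and every $\varepsilon\in(0,1]$. Run the four-round algorithm with parameters $k$, $\varepsilon'=a\varepsilon$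 and $\delta''=b\log n$. For every hash function the algorithm has an execution in which all local computations end. With probability at least $1-\frac2n$ over the hash function, in every execution, that is, whatever the arbitrary choices of edges and the ways of breaking ties are, the output is a $\left(1-\frac1e-\varepsilon\right)$-approximate solution to $k$-cover, and no machine uses more than $\tilde O(n)$ space; precisely, every machine uses at most $$\frac{K}{\varepsilon^4}\;n\,(\log n)^2\,\bigl(1+\log(1+\log m)\bigr)$$ words. -/

import Mathlib

open MeasureTheory

namespace KCover

/-! ### The `k`-cover problem

An instance is a family `A : F → Finset E` of `n = |F|` subsets of a ground set `E` of `m` elements,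
or, equivalently, the bipartite graph with an edge `(S, v)` whenever `v ∈ A S`. -/

/-- The coverage function: the size of the union of the sets of a subfamily. -/
def coverage {F E : Type*} [DecidableEq E] (A : F → Finset E) (T : Finset F) : ℕ :=
  (T.biUnion A).card

/-- The neighbours of an element: the sets that contain it. -/
def neighbours {F E : Type*} [Fintype F] [DecidableEq E] (A : F → Finset E) (v : E) : Finset F :=
  Finset.univ.filter fun S => v ∈ A S

/-- `T` is an `α`-approximate solution to `k`-cover. -/
def IsApproxSolution {F E : Type*} [DecidableEq E] (A : F → Finset E) (k : ℕ) (α : ℝ)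
    (T : Finset F) : Prop :=
  T.card = k ∧ ∀ T' : Finset F, T'.card = k → α * (coverage A T' : ℝ) ≤ (coverage A T : ℝ)

/-! ### Parameters of the algorithm -/

/-- The quantities that every machine knows: the numbers `n` of sets and `m` of elements, the
number `k` of sets to choose, and the two parameters of the sketch. -/
structure Params where
  /-- number of sets -/
  n : ℕ
  /-- number of elements -/
  m : ℕ
  /-- number of sets to choose -/
  k : ℕ
  /-- accuracy parameter of the sketch -/
  eps : ℝ
  /-- confidence parameter of the sketch -/
  conf : ℝ

namespace Params

/-- `δ = δ'' log log_{1/(1-ε)} m`. -/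
noncomputable def delta (P : Params) : ℝ :=
  P.conf * Real.log (Real.logb (1 / (1 - P.eps)) P.m)

/-- `ñ = 24 n δ log(1/ε) log n / ((1-ε) ε³)`, the number of edges the sketch has to reach. -/
noncomputable def nTilde (P : Params) : ℝ :=
  24 * P.n * P.delta * Real.log (1 / P.eps) * Real.log P.n / ((1 - P.eps) * P.eps ^ 3)

/-- `Δ = n log(1/ε) / (ε k)`, rounded down: the largest degree of an element in the sketch. -/
noncomputable def maxDegree (P : Params) : ℕ :=
  ⌊(P.n * Real.log (1 / P.eps) / (P.eps * P.k) : ℝ)⌋₊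

end Params

/-! ### Machines, messages and memory -/

/-- Machine one, and a distinct machine for every element. -/
inductive Machine (E : Type*)
  | one
  | elem (v : E)
  deriving DecidableEq

/-- Messages: an element with its hash value and its degree; the information that an element has
been selected (sent to the machine of that element); an edge of the graph. -/
inductive Msg (F E : Type*)
  | report (v : E) (x : ℝ) (d : ℕ)
  | selected
  | edge (S : F) (v : E)

/-- Size of a message in words. The name of a set, the name of an element, a degree, and a hash
value take one word each. -/
def Msg.words {F E : Type*} : Msg F E → ℕ
  | .report _ _ _ => 3
  | .selected => 1
  | .edge _ _ => 2

/-- What a machine has in memory: received messages, addressed messages to be delivered at the end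
of the round, the adjacency list and the hash value of its element, an integer register, and a list
of chosen sets. -/
structure Memory (F E : Type*) where
  /-- received messages -/
  inbox : Multiset (Msg F E)
  /-- outgoing messages with their addressees -/
  outbox : Multiset (Machine E × Msg F E)
  /-- adjacency list -/
  nbrs : Finset F
  /-- hash value -/
  hash : ℝ
  /-- register -/
  total : ℕ
  /-- chosen sets -/
  sol : Finset F

/-- Number of words in memory. An outgoing message takes one more word for its addressee. -/
def Memory.words {F E : Type*} (c : Memory F E) : ℕ :=
  (c.inbox.map Msg.words).sum + (c.outbox.map fun p => p.2.words + 1).sum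
    + c.nbrs.card + 1 + 1 + c.sol.card

/-- The number of elements that the sets in `T` cover in the graph whose edges are in the inbox. -/
noncomputable def Memory.sketchCoverage {F E : Type*} (c : Memory F E) (T : Finset F) : ℕ :=
  {v : E | ∃ S ∈ T, Msg.edge S v ∈ c.inbox}.ncard

/-! ### The algorithm -/

/-- One step of the local computation of a machine in a round (the four rounds are numbered from
`0` to `3`). A step sees only the memory of that machine and the common parameters; all arbitrary
choices of the algorithm are left open. A machine with no possible step has finished the round. -/
inductive Step {F E : Type*} [DecidableEq F] (P : Params) :
    Fin 4 → Machine E → Memory F E → Memory F E → Prop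
  /-- First round: the machine of an element whose hash value is at most `2ñ/m` sends the hash value
  and the degree to machine one. -/
  | report (v : E) (c : Memory F E) (hhash : c.hash ≤ 2 * P.nTilde / P.m) (hout : c.outbox = 0) :
      Step P 0 (.elem v) c { c with outbox := {(.one, .report v c.hash c.nbrs.card)} }
  /-- Second round: as long as the edges counted so far are fewer than `ñ`, machine one takes a
  remaining element with the smallest hash value, counts the edges that this element has in the
  sketch, and informs its machine. -/
  | select (c : Memory F E) (v : E) (x : ℝ) (d : ℕ) (rest : Multiset (Msg F E))
      (hin : c.inbox = Msg.report v x d ::ₘ rest)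
      (hmin : ∀ v' x' d', Msg.report v' x' d' ∈ rest → x ≤ x')
      (hlt : (c.total : ℝ) < P.nTilde) :
      Step P 1 .one c
        { c with
          inbox := rest
          outbox := (.elem v, .selected) ::ₘ c.outbox
          total := c.total + min d P.maxDegree }
  /-- Third round: the machine of a selected element sends all edges of the element, or arbitrary
  `Δ` of them, if there are more, to machine one. -/
  | send (v : E) (c : Memory F E) (rest : Multiset (Msg F E)) (T : Finset F)
      (hin : c.inbox = Msg.selected ::ₘ rest)
      (hT : T ⊆ c.nbrs) (hcard : T.card = min c.nbrs.card P.maxDegree) :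
      Step P 2 (.elem v) c
        { c with
          inbox := rest
          outbox := c.outbox + T.val.map fun S => (.one, .edge S v) }
  /-- Fourth round: machine one runs the greedy algorithm on the graph that it has received. As long
  as fewer than `k` sets are chosen, it adds one that maximizes the coverage. -/
  | greedy (c : Memory F E) (S : F) (hk : c.sol.card < P.k) (hS : S ∉ c.sol)
      (hmax : ∀ S' ∉ c.sol,
        c.sketchCoverage (insert S' c.sol) ≤ c.sketchCoverage (insert S c.sol)) :
      Step P 3 .one c { c with sol := insert S c.sol }

/-- The input: the machine of an element has its edges and its hash value. -/
def initial {F E : Type*} [Fintype F] [DecidableEq E] (A : F → Finset E) (h : E → unitInterval) :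
    Machine E → Memory F E
  | .one => ⟨0, 0, ∅, 0, 0, ∅⟩
  | .elem v => ⟨0, 0, neighbours A v, h v, 0, ∅⟩

/-- Between two rounds all messages are delivered, and messages of the round before are dropped. -/
def deliver {F E : Type*} [Fintype E] [DecidableEq E] (c : Machine E → Memory F E)
    (i : Machine E) : Memory F E :=
  { c i with
    inbox :=
      (((c .one).outbox + ∑ v, (c (.elem v)).outbox).filter fun p => p.1 = i).map Prod.snd
    outbox := 0 }

/-- An execution of the algorithm with hash function `h`: four rounds, in each of which every machine
starts from its memory with the messages sent to it in the previous round and computes locally until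
it has no further step. -/
structure Execution {F E : Type*} [Fintype F] [DecidableEq F] [Fintype E] [DecidableEq E]
    (P : Params) (A : F → Finset E) (h : E → unitInterval) where
  /-- memory at the start of a round -/
  start : Fin 4 → Machine E → Memory F E
  /-- memory at the end of a round -/
  final : Fin 4 → Machine E → Memory F E
  start_zero : start 0 = initial A h
  start_succ : ∀ r : Fin 3, start r.succ = deliver (final r.castSucc)
  computes : ∀ r i, Relation.ReflTransGen (Step P r i) (start r i) (final r i)
  halts : ∀ r i c, ¬ Step P r i (final r i) c

namespace Execution

variable {F E : Type*} [Fintype F] [DecidableEq F] [Fintype E] [DecidableEq E]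
  {P : Params} {A : F → Finset E} {h : E → unitInterval}

/-- The output: the sets that machine one has chosen at the end of the fourth round. -/
def output (x : Execution P A h) : Finset F := (x.final 3 .one).sol

/-- No machine ever has more than `B` words in memory: neither in this execution, nor in whatever
other way its local computation in a round might have gone. -/
def SpaceAtMost (x : Execution P A h) (B : ℝ) : Prop :=
  ∀ r i c, Relation.ReflTransGen (Step P r i) (x.start r i) c → (c.words : ℝ) ≤ B

end Execution

end KCover

/-!
Machine one sees the subgraph on a set `X` of elements with smallest hash values, in which the
degrees are capped at `Δ`. The output is good for the whole instance for three reasons.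

* *Capping.* Adding `3εk` suitable sets to an optimal family covers again all but a fraction `ε` of
  the elements that have lost edges. The greedy algorithm hardly notices that its competitor has
  `k + 3εk` sets instead of `k`. So the output covers nearly `1 - 1/e` times as much of `X` as the
  optimum does in the uncapped graph, whatever edges have been kept (`GreedyBound.capped`). Only the
  uncapped coverages have to be controlled by probability, which is why the arbitrary choices of the
  algorithm do no harm.
* *Size.* Unless `X` is the whole ground set, the sketch has at least `ñ` edges
  (`eq_univ_or_nTilde_le`), and as the degrees are at most `Δ`, some `k` sets cover at least `4Q`
  elements of it, where `Q` is `Params.threshold` (`exists_hits_ge_threshold`).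
* *Sampling.* By a Chernoff bound and a union bound, the coverages of all families of `k` sets are
  preserved when elements are sampled at one of the rates `(1-ε)^j` for which the optimum has at
  least `Q` sampled elements in expectation (`volume_not_samplesWell_le`). The union is over at most
  `log_{1/(1-ε)} m + 1` rates, whose logarithm is the factor `log log` in `δ`. The set `X` lies
  between the samples at two consecutive rates, and these rates are good by the bound on its size,
  so that coverages in `X` reflect those in the whole instance (`le_hits_of_samplesWell`). This
  needs no assumption that the hash values be distinct.

For the space, the machines hold `O(n)` words besides the reports, of which there are at most `4ñ`
with high probability (`volume_not_reportsWell_le`), and the sketch, which has at most `ñ + Δ` edges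
because the selection stops as soon as `ñ` is reached (`Execution.exists_selection`).
-/

/-! ### Covering in a bipartite graph -/

namespace KCover

/-- The number of elements of `X` that the sets in `T` cover, in the graph in which `B v` is the
set of neighbours of the element `v`. -/
def hits {F E : Type*} [DecidableEq F] (B : E → Finset F) (X : Finset E) (T : Finset F) : ℕ :=
  (X.filter fun v => ∃ S ∈ T, S ∈ B v).card

section Covering

variable {F E : Type*} [DecidableEq F] {B : E → Finset F} {X : Finset E}

theorem hits_le_card (T : Finset F) : hits B X T ≤ X.card :=
  Finset.card_filter_le _ _

theorem hits_mono_left {Y : Finset E} (h : X ⊆ Y) (T : Finset F) : hits B X T ≤ hits B Y T :=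
  Finset.card_le_card (Finset.filter_subset_filter _ h)

theorem hits_mono_right {T T' : Finset F} (h : T ⊆ T') : hits B X T ≤ hits B X T' :=
  Finset.card_le_card (Finset.monotone_filter_right _ fun _ _ ⟨S, hS, hv⟩ => ⟨S, h hS, hv⟩)

theorem hits_mono_graph {N : E → Finset F} (h : ∀ v ∈ X, B v ⊆ N v) (T : Finset F) :
    hits B X T ≤ hits N X T := by
  refine Finset.card_le_card fun v hv => ?_
  rw [Finset.mem_filter] at hv ⊢
  obtain ⟨hX, S, hS, hv⟩ := hv
  exact ⟨hX, S, hS, h v hX hv⟩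

theorem hits_empty : hits B X ∅ = 0 := by simp [hits]

theorem hits_insert (S : F) (T : Finset F) :
    hits B X (insert S T) =
      hits B X T + ((X.filter fun v => ¬ ∃ S' ∈ T, S' ∈ B v).filter fun v => S ∈ B v).card := by
  classical
  rw [hits, hits, ← Finset.card_union_of_disjoint]
  · congr 1
    ext v
    by_cases h : ∃ S' ∈ T, S' ∈ B v <;>
      simp only [Finset.mem_filter, Finset.mem_union, Finset.mem_insert, exists_eq_or_imp, h] <;>
      tauto
  · rw [Finset.disjoint_left]
    intro v hv hv'
    simp only [Finset.mem_filter] at hv hv'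
    exact hv'.1.2 hv.2

theorem hits_add_card_unhit (T : Finset F) :
    hits B X T + (X.filter fun v => ¬ ∃ S' ∈ T, S' ∈ B v).card = X.card :=
  Finset.card_filter_add_card_filter_not _

/-- Some set contains at least the average number of elements of `U`. -/
theorem exists_card_fiber_ge [Fintype F] [Nonempty F] (B : E → Finset F) (U : Finset E) :
    ∃ S, ∑ v ∈ U, (B v).card ≤ Fintype.card F * (U.filter fun v => S ∈ B v).card := by
  obtain ⟨S, hS⟩ := Finite.exists_max fun S => (U.filter fun v => S ∈ B v).card
  refine ⟨S, ?_⟩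
  have h1 : ∑ v ∈ U, (B v).card = ∑ S : F, (U.filter fun v => S ∈ B v).card := by
    have := Finset.sum_card_bipartiteAbove_eq_sum_card_bipartiteBelow
      (s := U) (t := (Finset.univ : Finset F)) (fun v S => S ∈ B v)
    simpa [Finset.bipartiteAbove, Finset.bipartiteBelow] using this
  rw [h1]
  exact (Finset.sum_le_card_nsmul _ _ _ fun S' _ => hS S').trans (by simp)

/-- If all elements of `U` have degree at least `d`, then picking the best set `r` times leaves at
most a fraction `(1 - d/n)^r` of `U` uncovered. -/
theorem exists_hitting [Fintype F] [Nonempty F] {U : Finset E} {d : ℕ}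
    (hd : ∀ v ∈ U, d ≤ (B v).card) (hdn : d ≤ Fintype.card F) (r : ℕ) :
    ∃ R : Finset F, R.card ≤ r ∧
      (U.card : ℝ) - hits B U R ≤ (1 - (d : ℝ) / Fintype.card F) ^ r * U.card := by
  have hn : (0 : ℝ) < Fintype.card F := by exact_mod_cast Fintype.card_pos
  induction r with
  | zero => exact ⟨∅, by simp, by simp [hits_empty]⟩
  | succ r ih =>
    obtain ⟨R, hR, hU⟩ := ih
    set W := U.filter fun v => ¬ ∃ S' ∈ R, S' ∈ B v with hW
    obtain ⟨S, hS⟩ := exists_card_fiber_ge B W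
    refine ⟨insert S R, (Finset.card_insert_le _ _).trans (by omega), ?_⟩
    have h1 := hits_insert (B := B) (X := U) S R
    have h2 := hits_add_card_unhit (B := B) (X := U) R
    rw [← hW] at h1 h2
    have h3 : W.card * d ≤ ∑ v ∈ W, (B v).card := by
      rw [← smul_eq_mul]
      exact Finset.card_nsmul_le_sum _ _ _ fun v hv => hd v (Finset.mem_filter.1 hv).1
    have h4 : (W.card : ℝ) * d ≤ Fintype.card F * (W.filter fun v => S ∈ B v).card := by
      exact_mod_cast h3.trans hS
    have h5 : (W.card : ℝ) * (d / Fintype.card F) ≤ (W.filter fun v => S ∈ B v).card := by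
      rw [← mul_div_assoc, div_le_iff₀ hn]; linarith
    have h6 : (hits B U R : ℝ) + W.card = U.card := by exact_mod_cast h2
    have h7 : 0 ≤ 1 - (d : ℝ) / Fintype.card F := by
      rw [sub_nonneg, div_le_one hn]; exact_mod_cast hdn
    rw [h1, pow_succ]
    push_cast
    have h8 : (W.card : ℝ) ≤ (1 - (d : ℝ) / Fintype.card F) ^ r * U.card := by linarith
    nlinarith [mul_le_mul_of_nonneg_right h8 h7]

/-- With degrees at most `Δ` and `D` edges in total, some `i` sets cover at least
`min (iD/(2n), D/(2Δ))` elements: as long as at least half of the edges are at uncovered elements,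
the best set covers `D/(2n)` new ones. -/
theorem exists_hits_ge [Fintype F] [Nonempty F] {D Δ : ℕ} (hΔ : ∀ v ∈ X, (B v).card ≤ Δ)
    (hD : ∑ v ∈ X, (B v).card = D) (i : ℕ) :
    ∃ T : Finset F, T.card ≤ i ∧
      (i * D ≤ 2 * Fintype.card F * hits B X T ∨ D ≤ 2 * Δ * hits B X T) := by
  induction i with
  | zero => exact ⟨∅, by simp, by simp⟩
  | succ i ih =>
    obtain ⟨T, hT, h⟩ := ih
    by_cases hbig : D ≤ 2 * Δ * hits B X T
    · exact ⟨T, by omega, Or.inr hbig⟩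
    have h := h.resolve_right hbig
    set W := X.filter fun v => ¬ ∃ S' ∈ T, S' ∈ B v with hW
    obtain ⟨S, hS⟩ := exists_card_fiber_ge B W
    refine ⟨insert S T, (Finset.card_insert_le _ _).trans (by omega), Or.inl ?_⟩
    rw [hits_insert, ← hW]
    have h1 : ∑ v ∈ X.filter (fun v => ∃ S' ∈ T, S' ∈ B v), (B v).card + ∑ v ∈ W, (B v).card
        = D := by
      rw [← hD]; exact Finset.sum_filter_add_sum_filter_not _ _ _
    have h2 : ∑ v ∈ X.filter (fun v => ∃ S' ∈ T, S' ∈ B v), (B v).card ≤ hits B X T * Δ := by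
      rw [hits, ← smul_eq_mul]
      exact Finset.sum_le_card_nsmul _ _ _ fun v hv => hΔ v (Finset.mem_filter.1 hv).1
    have h3 : D ≤ 2 * Fintype.card F * (W.filter fun v => S ∈ B v).card := by nlinarith
    nlinarith

/-- What the sets in `T'` cover beyond `T` is at most the sum of their marginal gains. -/
theorem hits_sub_le_sum_gain (T T' : Finset F) :
    (hits B X T' : ℝ) - hits B X T ≤
      ∑ S ∈ T', ((hits B X (insert S T) : ℝ) - hits B X T) := by
  classical
  have h : hits B X T' ≤ hits B X T +
      ∑ S ∈ T', ((X.filter fun v => ¬ ∃ S' ∈ T, S' ∈ B v).filter fun v => S ∈ B v).card := by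
    refine le_trans (Finset.card_le_card (t := (X.filter fun v => ∃ S' ∈ T, S' ∈ B v) ∪
      T'.biUnion fun S => (X.filter fun v => ¬ ∃ S' ∈ T, S' ∈ B v).filter fun v => S ∈ B v) ?_)
      ((Finset.card_union_le _ _).trans (Nat.add_le_add_left Finset.card_biUnion_le _))
    intro v hv
    simp only [Finset.mem_filter, Finset.mem_union, Finset.mem_biUnion] at hv ⊢
    by_cases hT : ∃ S' ∈ T, S' ∈ B v
    · exact Or.inl ⟨hv.1, hT⟩
    · obtain ⟨hX, S, hS, hSv⟩ := hv
      exact Or.inr ⟨S, hS, ⟨hX, hT⟩, hSv⟩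
  have h' : (hits B X T' : ℝ) ≤ hits B X T + ∑ S ∈ T',
      (((X.filter fun v => ¬ ∃ S' ∈ T, S' ∈ B v).filter fun v => S ∈ B v).card : ℝ) := by
    exact_mod_cast h
  simp only [hits_insert]
  push_cast
  simp only [add_sub_cancel_left]
  linarith

/-- A greedy choice closes a `1/|T'|` fraction of the gap to any competitor `T'`. -/
theorem greedy_step {T : Finset F} {S : F}
    (hmax : ∀ S' ∉ T, hits B X (insert S' T) ≤ hits B X (insert S T))
    {T' : Finset F} (hT' : T'.Nonempty) :
    (hits B X T' : ℝ) - hits B X (insert S T) ≤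
      (1 - 1 / (T'.card : ℝ)) * (hits B X T' - hits B X T) := by
  have hq : (0 : ℝ) < T'.card := by exact_mod_cast hT'.card_pos
  have h1 : (hits B X T' : ℝ) - hits B X T ≤
      T'.card * ((hits B X (insert S T) : ℝ) - hits B X T) := by
    refine (hits_sub_le_sum_gain T T').trans ?_
    rw [← nsmul_eq_mul]
    refine Finset.sum_le_card_nsmul _ _ _ fun S' _ => sub_le_sub_right ?_ _
    by_cases hS' : S' ∈ T
    · rw [Finset.insert_eq_self.2 hS']
      exact Nat.cast_le.2 (hits_mono_right (Finset.subset_insert _ _))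
    · exact_mod_cast hmax S' hS'
  have h2 : ((hits B X T' : ℝ) - hits B X T) / T'.card ≤
      (hits B X (insert S T) : ℝ) - hits B X T := by
    rw [div_le_iff₀ hq]; linarith
  have h3 : (1 - 1 / (T'.card : ℝ)) * ((hits B X T' : ℝ) - hits B X T) =
      (hits B X T' : ℝ) - hits B X T - ((hits B X T' : ℝ) - hits B X T) / T'.card := by ring
  rw [h3]; linarith

/-- The greedy guarantee: `T` closes the gap to every competitor at the rate of a greedy choice of
`|T|` sets. -/
def GreedyBound {F E : Type*} [DecidableEq F] (B : E → Finset F) (X : Finset E) (T : Finset F) :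
    Prop :=
  ∀ T' : Finset F, T'.Nonempty →
    (hits B X T' : ℝ) - hits B X T ≤ (1 - 1 / (T'.card : ℝ)) ^ T.card * hits B X T'

theorem greedyBound_empty : GreedyBound B X ∅ := fun T' _ => by simp [hits_empty]

theorem GreedyBound.insert {T : Finset F} (hT : GreedyBound B X T) {S : F} (hS : S ∉ T)
    (hmax : ∀ S' ∉ T, hits B X (insert S' T) ≤ hits B X (insert S T)) :
    GreedyBound B X (insert S T) := by
  intro T' hT'
  have hq : (1 : ℝ) ≤ T'.card := by exact_mod_cast hT'.card_pos
  have h0 : 0 ≤ 1 - 1 / (T'.card : ℝ) := by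
    rw [sub_nonneg, div_le_one (by linarith)]; exact hq
  rw [Finset.card_insert_of_notMem hS, pow_succ]
  refine (greedy_step hmax hT').trans ?_
  nlinarith [mul_le_mul_of_nonneg_left (hT T' hT') h0]

/-- Greedy against a competitor of `q ≤ k(1 + 3ε)` sets loses a factor `1 - 1/e - 3ε` only. -/
theorem GreedyBound.le_hits {T T' : Finset F} (hT : GreedyBound B X T) (hk : 1 ≤ T.card)
    (hT' : T'.Nonempty) {ε : ℝ} (hε : 0 ≤ ε) (hε' : ε ≤ 1 / 20)
    (hq : (T'.card : ℝ) ≤ T.card * (1 + 3 * ε)) :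
    (1 - 1 / Real.exp 1 - 3 * ε) * hits B X T' ≤ hits B X T := by
  have hk' : (1 : ℝ) ≤ T.card := by exact_mod_cast hk
  have hq1 : (1 : ℝ) ≤ T'.card := by exact_mod_cast hT'.card_pos
  have h0 : 0 ≤ 1 - 1 / (T'.card : ℝ) := by
    rw [sub_nonneg, div_le_one (by linarith)]; exact hq1
  have h1 : (1 - 1 / (T'.card : ℝ)) ^ T.card ≤ Real.exp (-1 + 3 * ε) := by
    calc (1 - 1 / (T'.card : ℝ)) ^ T.card ≤ (Real.exp (-(1 / (T'.card : ℝ)))) ^ T.card :=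
          pow_le_pow_left₀ h0 (Real.one_sub_le_exp_neg _) _
      _ = Real.exp (-(T.card / T'.card)) := by
          rw [← Real.exp_nat_mul]; congr 1; ring
      _ ≤ Real.exp (-1 + 3 * ε) := by
          apply Real.exp_le_exp.2
          have : 1 - 3 * ε ≤ (T.card : ℝ) / T'.card := by
            rw [le_div_iff₀ (by linarith)]
            calc (1 - 3 * ε) * T'.card ≤ (1 - 3 * ε) * (T.card * (1 + 3 * ε)) :=
                  mul_le_mul_of_nonneg_left hq (by linarith)
              _ ≤ T.card := by nlinarith [mul_nonneg (sq_nonneg ε) (by linarith : (0:ℝ) ≤ T.card)]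
          linarith
  have h2 : Real.exp (-1 + 3 * ε) ≤ 1 / Real.exp 1 + 3 * ε := by
    have h3 : Real.exp (3 * ε) ≤ 1 + 6 * ε := by
      have := abs_le.1 (Real.abs_exp_sub_one_sub_id_le
        (x := 3 * ε) (by rw [abs_of_nonneg (by linarith)]; linarith))
      nlinarith [this.2]
    have h4 : Real.exp (-1) ≤ 1 / 2 := by
      rw [Real.exp_neg, inv_eq_one_div]
      apply one_div_le_one_div_of_le (by norm_num)
      linarith [Real.add_one_le_exp (1 : ℝ)]
    have h5 : (1 : ℝ) / Real.exp 1 = Real.exp (-1) := by rw [Real.exp_neg, inv_eq_one_div]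
    rw [Real.exp_add, h5]
    nlinarith [Real.exp_pos (-1)]
  have h6 := hT T' hT'
  have h7 : (0 : ℝ) ≤ hits B X T' := Nat.cast_nonneg _
  nlinarith [mul_le_mul_of_nonneg_right (h1.trans h2) h7]

/-- Capping degrees at `Δ` costs the greedy algorithm little. The competitor is an optimal `T₀`
together with `r ≤ 3εk` sets that cover all but a fraction `ε` of the elements which have lost
edges, so that together they cover in the capped graph what `T₀` covers in the full one, up to a
factor `1 - ε`. -/
theorem GreedyBound.capped [Fintype F] {N : E → Finset F} {Δ r : ℕ} {T T₀ : Finset F} {ε : ℝ}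
    (hT : GreedyBound B X T) (hT1 : 1 ≤ T.card) (hT₀ : T₀.card = T.card)
    (hBN : ∀ v ∈ X, B v ⊆ N v) (hcard : ∀ v ∈ X, (B v).card = min (N v).card Δ)
    (hε : 0 < ε) (hε' : ε ≤ 1 / 20) (hr : (r : ℝ) ≤ 3 * ε * T.card)
    (hΔ : Fintype.card F ≤ Δ ∨
      (Δ ≤ Fintype.card F ∧ (1 - (Δ : ℝ) / Fintype.card F) ^ r ≤ ε)) :
    (1 - 1 / Real.exp 1 - 4 * ε) * hits N X T₀ ≤ hits B X T := by
  classical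
  have hT₀' : T₀.Nonempty := Finset.card_pos.1 (by omega)
  obtain ⟨S₀, hS₀⟩ := hT₀'
  have : Nonempty F := ⟨S₀⟩
  set Y := X.filter fun v => ∃ S ∈ T₀, S ∈ N v with hY
  set U := Y.filter fun v => ¬ ∃ S ∈ T₀, S ∈ B v with hU
  have hUd : ∀ v ∈ U, Δ < (N v).card := by
    intro v hv
    obtain ⟨hv, hn⟩ := Finset.mem_filter.1 hv
    obtain ⟨hX, S, hS, hSv⟩ := Finset.mem_filter.1 hv
    by_contra hle
    have : B v = N v := Finset.eq_of_subset_of_card_le (hBN v hX)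
      (by rw [hcard v hX]; omega)
    exact hn ⟨S, hS, this ▸ hSv⟩
  have hUX : U ⊆ X := (Finset.filter_subset _ _).trans (Finset.filter_subset _ _)
  obtain ⟨R, hR, hUR⟩ : ∃ R : Finset F, R.card ≤ r ∧ (U.card : ℝ) - hits B U R ≤ ε * U.card := by
    rcases hΔ with h | ⟨h1, h2⟩
    · have : U = ∅ := Finset.eq_empty_of_forall_notMem fun v hv => by
        have := hUd v hv
        have := Finset.card_le_univ (N v)
        omega
      exact ⟨∅, by simp, by simp [this]⟩
    · obtain ⟨R, hR, hUR⟩ := exists_hitting (B := B) (U := U) (d := Δ)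
        (fun v hv => by rw [hcard v (hUX hv)]; have := hUd v hv; omega) h1 r
      exact ⟨R, hR, hUR.trans (mul_le_mul_of_nonneg_right h2 (Nat.cast_nonneg _))⟩
  have hge : (1 - ε) * hits N X T₀ ≤ hits B X (T₀ ∪ R) := by
    have h1 : (Y.filter fun v => ∃ S ∈ T₀, S ∈ B v).card + U.card = hits N X T₀ :=
      Finset.card_filter_add_card_filter_not _
    have h2 : (Y.filter fun v => ∃ S ∈ T₀, S ∈ B v).card + hits B U R ≤ hits B X (T₀ ∪ R) := by
      rw [hits, hits, ← Finset.card_union_of_disjoint]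
      · refine Finset.card_le_card fun v hv => ?_
        simp only [Finset.mem_union, Finset.mem_filter] at hv ⊢
        rcases hv with ⟨hv, S, hS, hSv⟩ | ⟨hv, S, hS, hSv⟩
        · exact ⟨(Finset.mem_filter.1 hv).1, S, Or.inl hS, hSv⟩
        · exact ⟨hUX hv, S, Or.inr hS, hSv⟩
      · rw [Finset.disjoint_left]
        intro v hv hv'
        exact (Finset.mem_filter.1 (Finset.mem_filter.1 hv').1).2 (Finset.mem_filter.1 hv).2
    have h1' : ((Y.filter fun v => ∃ S ∈ T₀, S ∈ B v).card : ℝ) + U.card = hits N X T₀ := by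
      exact_mod_cast h1
    have h2' : ((Y.filter fun v => ∃ S ∈ T₀, S ∈ B v).card : ℝ) + hits B U R ≤
        hits B X (T₀ ∪ R) := by exact_mod_cast h2
    have h3 : (0 : ℝ) ≤ (Y.filter fun v => ∃ S ∈ T₀, S ∈ B v).card := Nat.cast_nonneg _
    nlinarith
  have hq : ((T₀ ∪ R).card : ℝ) ≤ T.card * (1 + 3 * ε) := by
    have : ((T₀ ∪ R).card : ℝ) ≤ T₀.card + r := by
      exact_mod_cast (Finset.card_union_le _ _).trans (Nat.add_le_add_left hR _)
    rw [hT₀] at this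
    linarith
  have hmain := hT.le_hits hT1 ⟨S₀, Finset.mem_union_left _ hS₀⟩ hε.le hε' hq
  have h4 : (1 : ℝ) / Real.exp 1 ≤ 1 / 2 := by
    apply one_div_le_one_div_of_le (by norm_num)
    linarith [Real.add_one_le_exp (1 : ℝ)]
  have h5 : (0 : ℝ) < 1 / Real.exp 1 := by positivity
  have h6 : (0 : ℝ) ≤ hits N X T₀ := Nat.cast_nonneg _
  calc (1 - 1 / Real.exp 1 - 4 * ε) * hits N X T₀
      ≤ (1 - 1 / Real.exp 1 - 3 * ε) * ((1 - ε) * hits N X T₀) := by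
        rw [← mul_assoc]
        exact mul_le_mul_of_nonneg_right (by nlinarith) h6
    _ ≤ (1 - 1 / Real.exp 1 - 3 * ε) * hits B X (T₀ ∪ R) :=
        mul_le_mul_of_nonneg_left hge (by linarith)
    _ ≤ hits B X T := hmain

theorem coverage_eq_hits [Fintype F] [Fintype E] [DecidableEq E] (A : F → Finset E)
    (T : Finset F) : coverage A T = hits (neighbours A) Finset.univ T := by
  rw [coverage, hits]
  congr 1
  ext v
  simp [neighbours]

end Covering

end KCover

/-! ### Concentration of the number of sampled elements -/

namespace KCover

/-- The elements whose hash value is at most `p`. -/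
noncomputable def sample {E : Type*} [Fintype E] (h : E → unitInterval) (p : ℝ) : Finset E :=
  {v | (h v : ℝ) ≤ p}

section Sampling

variable {E : Type*} [Fintype E]

theorem mem_sample {h : E → unitInterval} {p : ℝ} {v : E} : v ∈ sample h p ↔ (h v : ℝ) ≤ p := by
  simp [sample]

theorem volume_real_coe_le {p : ℝ} (hp : 0 ≤ p) (hp1 : p ≤ 1) :
    (volume : Measure unitInterval).real {x | (x : ℝ) ≤ p} = p := by
  have : {x : unitInterval | (x : ℝ) ≤ p} = Set.Iic ⟨p, hp, hp1⟩ := by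
    ext x; exact Iff.rfl
  rw [this, measureReal_def, unitInterval.volume_Iic, ENNReal.toReal_ofReal hp]

theorem integral_exp_mul_card_sample_le [DecidableEq E] (Y : Finset E) {p s : ℝ} (hp : 0 ≤ p)
    (hp1 : p ≤ 1) (hs : |s| ≤ 1) :
    ∫ h : E → unitInterval, Real.exp (s * ((sample h p ∩ Y).card : ℝ)) ≤
      Real.exp (p * Y.card * (s + s ^ 2)) := by
  set f : E → unitInterval → ℝ := fun v x =>
    if v ∈ Y then 1 + Set.indicator {x : unitInterval | (x : ℝ) ≤ p} (fun _ => Real.exp s - 1) x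
    else 1 with hf
  have hprod : ∀ h : E → unitInterval,
      Real.exp (s * ((sample h p ∩ Y).card : ℝ)) = ∏ v, f v (h v) := by
    intro h
    have h1 : ∀ v, f v (h v) = if v ∈ sample h p ∩ Y then Real.exp s else 1 := by
      intro v
      by_cases hv : v ∈ Y <;> by_cases hv' : (h v : ℝ) ≤ p <;>
        simp [hf, hv, hv', mem_sample, Set.indicator]
    simp_rw [h1]
    rw [Finset.prod_ite_mem, Finset.univ_inter, Finset.prod_const, ← Real.exp_nat_mul, mul_comm]
  simp_rw [hprod]
  rw [integral_fintype_prod_volume_eq_prod]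
  have hmeas : MeasurableSet {x : unitInterval | (x : ℝ) ≤ p} :=
    measurableSet_le measurable_subtype_coe measurable_const
  have hint : ∀ v, ∫ x, f v x = if v ∈ Y then 1 + p * (Real.exp s - 1) else 1 := by
    intro v
    by_cases hv : v ∈ Y
    · simp only [hf, hv, if_true]
      rw [integral_add (integrable_const _) ((integrable_const _).indicator hmeas),
        integral_indicator_const _ hmeas, volume_real_coe_le hp hp1]
      simp
    · simp [hf, hv]
  simp_rw [hint]
  rw [Finset.prod_ite_mem, Finset.univ_inter, Finset.prod_const]
  have h2 : Real.exp s - 1 ≤ s + s ^ 2 := by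
    linarith [(abs_le.1 (Real.abs_exp_sub_one_sub_id_le hs)).2]
  have h3 : 1 + p * (Real.exp s - 1) ≤ Real.exp (p * (s + s ^ 2)) := by
    linarith [Real.add_one_le_exp (p * (s + s ^ 2)), mul_le_mul_of_nonneg_left h2 hp]
  have h4 : 0 ≤ 1 + p * (Real.exp s - 1) := by nlinarith [Real.exp_pos s]
  calc (1 + p * (Real.exp s - 1)) ^ Y.card ≤ Real.exp (p * (s + s ^ 2)) ^ Y.card :=
        pow_le_pow_left₀ h4 h3 _
    _ = Real.exp (p * Y.card * (s + s ^ 2)) := by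
        rw [← Real.exp_nat_mul]; congr 1; ring

/-- The Chernoff bound for the number of sampled elements of `Y`, for both tails: positive `s` gives
the upper one, negative `s` the lower one. -/
theorem chernoff [DecidableEq E] (Y : Finset E) {p s : ℝ} (t : ℝ) (hp : 0 ≤ p) (hp1 : p ≤ 1)
    (hs : |s| ≤ 1) :
    (volume : Measure (E → unitInterval)) {h | t ≤ s * ((sample h p ∩ Y).card : ℝ)} ≤
      ENNReal.ofReal (Real.exp (p * Y.card * (s + s ^ 2) - t)) := by
  have hmeas : Measurable fun h : E → unitInterval =>
      Real.exp (s * ((sample h p ∩ Y).card : ℝ)) := by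
    have : ∀ h : E → unitInterval, ((sample h p ∩ Y).card : ℝ) =
        ∑ v ∈ Y, if (h v : ℝ) ≤ p then 1 else 0 := by
      intro h
      rw [Finset.sum_boole]
      congr 2
      ext v
      simp [mem_sample, and_comm]
    simp_rw [this]
    refine Real.measurable_exp.comp (Measurable.const_mul (Finset.measurable_sum _ fun v _ => ?_) _)
    exact Measurable.ite (measurableSet_le (measurable_subtype_coe.comp (measurable_pi_apply v))
      measurable_const) measurable_const measurable_const
  have hbdd : ∀ h : E → unitInterval,
      ‖Real.exp (s * ((sample h p ∩ Y).card : ℝ))‖ ≤ Real.exp Y.card := by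
    intro h
    rw [Real.norm_eq_abs, abs_of_pos (Real.exp_pos _)]
    apply Real.exp_le_exp.2
    have h1 : ((sample h p ∩ Y).card : ℝ) ≤ Y.card := by
      exact_mod_cast Finset.card_le_card Finset.inter_subset_right
    have h2 := (abs_le.1 hs).2
    nlinarith [Nat.cast_nonneg (α := ℝ) (sample h p ∩ Y).card]
  have hint : Integrable (fun h : E → unitInterval =>
      Real.exp (s * ((sample h p ∩ Y).card : ℝ))) :=
    Integrable.of_bound hmeas.aestronglyMeasurable _ (Filter.Eventually.of_forall hbdd)
  have hM := mul_meas_ge_le_integral_of_nonneg (μ := (volume : Measure (E → unitInterval)))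
    (Filter.Eventually.of_forall fun h => (Real.exp_pos _).le) hint (Real.exp t)
  have hset : {h : E → unitInterval | Real.exp t ≤ Real.exp (s * ((sample h p ∩ Y).card : ℝ))} =
      {h | t ≤ s * ((sample h p ∩ Y).card : ℝ)} := by
    ext h; simp
  rw [hset] at hM
  have hM' := hM.trans (integral_exp_mul_card_sample_le Y hp hp1 hs)
  rw [← ENNReal.ofReal_toReal (measure_ne_top _ _)]
  apply ENNReal.ofReal_le_ofReal
  rw [Real.exp_sub, le_div_iff₀ (Real.exp_pos _), mul_comm]
  exact hM'

theorem card_sample_inter {F : Type*} [DecidableEq F] [DecidableEq E] (N : E → Finset F)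
    (T : Finset F) (Z : Finset E) :
    (Z ∩ Finset.univ.filter fun v => ∃ S ∈ T, S ∈ N v).card = hits N Z T := by
  rw [hits]
  congr 1
  ext v
  simp

/-- The sampled coverage of `T` rarely exceeds its mean by `ε p M`, if `M` bounds the coverage. -/
theorem volume_hits_sample_gt_le {F : Type*} [DecidableEq F] [DecidableEq E] (N : E → Finset F)
    (T : Finset F) {p ε M : ℝ} (hp : 0 ≤ p) (hp1 : p ≤ 1) (hε : 0 ≤ ε) (hε1 : ε ≤ 1)
    (hM : (hits N Finset.univ T : ℝ) ≤ M) :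
    (volume : Measure (E → unitInterval))
      {h | p * hits N Finset.univ T + ε * p * M ≤ hits N (sample h p) T} ≤
      ENNReal.ofReal (Real.exp (-(ε ^ 2 * (p * M) / 4))) := by
  set Y := Finset.univ.filter fun v => ∃ S ∈ T, S ∈ N v with hY
  have hYc : (Y.card : ℝ) = hits N Finset.univ T := by rw [hits]
  refine le_trans (measure_mono ?_) ((chernoff Y
    (ε / 2 * (p * hits N Finset.univ T + ε * p * M)) hp hp1
    (s := ε / 2) (by rw [abs_of_nonneg (by linarith)]; linarith)).trans ?_)
  · intro h hh
    rw [Set.mem_ofPred_eq] at hh ⊢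
    rw [hY, card_sample_inter]
    exact mul_le_mul_of_nonneg_left hh (by linarith)
  · apply ENNReal.ofReal_le_ofReal
    apply Real.exp_le_exp.2
    rw [hYc]
    nlinarith [mul_le_mul_of_nonneg_left hM (by positivity : 0 ≤ p * (ε / 2) ^ 2)]

/-- The sampled coverage of `T` rarely falls below its mean by `ε p M`, if `M` bounds the
coverage. -/
theorem volume_hits_sample_lt_le {F : Type*} [DecidableEq F] [DecidableEq E] (N : E → Finset F)
    (T : Finset F) {p ε M : ℝ} (hp : 0 ≤ p) (hp1 : p ≤ 1) (hε : 0 ≤ ε) (hε1 : ε ≤ 1)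
    (hM : (hits N Finset.univ T : ℝ) ≤ M) :
    (volume : Measure (E → unitInterval))
      {h | (hits N (sample h p) T : ℝ) ≤ p * hits N Finset.univ T - ε * p * M} ≤
      ENNReal.ofReal (Real.exp (-(ε ^ 2 * (p * M) / 4))) := by
  set Y := Finset.univ.filter fun v => ∃ S ∈ T, S ∈ N v with hY
  have hYc : (Y.card : ℝ) = hits N Finset.univ T := by rw [hits]
  refine le_trans (measure_mono ?_) ((chernoff Y
    (-(ε / 2) * (p * hits N Finset.univ T - ε * p * M)) hp hp1
    (s := -(ε / 2)) (by rw [abs_neg, abs_of_nonneg (by linarith)]; linarith)).trans ?_)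
  · intro h hh
    rw [Set.mem_ofPred_eq] at hh ⊢
    rw [hY, card_sample_inter]
    nlinarith
  · apply ENNReal.ofReal_le_ofReal
    apply Real.exp_le_exp.2
    rw [hYc]
    nlinarith [mul_le_mul_of_nonneg_left hM (by positivity : 0 ≤ p * (ε / 2) ^ 2)]

end Sampling

end KCover

/-! ### Executions of the algorithm -/

namespace KCover

section Algorithm

variable {F E : Type*} [DecidableEq F] {P : Params}

theorem step_zero_iff {i : Machine E} {c c' : Memory F E} :
    Step P 0 i c c' ↔ ∃ v, i = .elem v ∧ c.hash ≤ 2 * P.nTilde / P.m ∧ c.outbox = 0 ∧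
      c' = { c with outbox := {(.one, .report v c.hash c.nbrs.card)} } := by
  constructor
  · generalize hr : (0 : Fin 4) = r
    intro hs
    cases hs with
    | report v _ h1 h2 => exact ⟨v, rfl, h1, h2, rfl⟩
    | _ => exact absurd hr (by decide)
  · rintro ⟨v, rfl, h1, h2, rfl⟩
    exact Step.report v c h1 h2

theorem step_one_iff {i : Machine E} {c c' : Memory F E} :
    Step P 1 i c c' ↔ i = .one ∧ ∃ v x d rest, c.inbox = Msg.report v x d ::ₘ rest ∧
      (∀ v' x' d', Msg.report v' x' d' ∈ rest → x ≤ x') ∧ (c.total : ℝ) < P.nTilde ∧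
      c' = { c with
          inbox := rest
          outbox := (.elem v, .selected) ::ₘ c.outbox
          total := c.total + min d P.maxDegree } := by
  constructor
  · generalize hr : (1 : Fin 4) = r
    intro hs
    cases hs with
    | select _ v x d rest h1 h2 h3 => exact ⟨rfl, v, x, d, rest, h1, h2, h3, rfl⟩
    | _ => exact absurd hr (by decide)
  · rintro ⟨rfl, v, x, d, rest, h1, h2, h3, rfl⟩
    exact Step.select c v x d rest h1 h2 h3

theorem step_two_iff {i : Machine E} {c c' : Memory F E} :
    Step P 2 i c c' ↔ ∃ v rest T, i = .elem v ∧ c.inbox = Msg.selected ::ₘ rest ∧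
      T ⊆ c.nbrs ∧ T.card = min c.nbrs.card P.maxDegree ∧
      c' = { c with
          inbox := rest
          outbox := c.outbox + T.val.map fun S => (.one, .edge S v) } := by
  constructor
  · generalize hr : (2 : Fin 4) = r
    intro hs
    cases hs with
    | send v _ rest T h1 h2 h3 => exact ⟨v, rest, T, rfl, h1, h2, h3, rfl⟩
    | _ => exact absurd hr (by decide)
  · rintro ⟨v, rest, T, rfl, h1, h2, h3, rfl⟩
    exact Step.send v c rest T h1 h2 h3

theorem step_three_iff {i : Machine E} {c c' : Memory F E} :
    Step P 3 i c c' ↔ i = .one ∧ ∃ S, c.sol.card < P.k ∧ S ∉ c.sol ∧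
      (∀ S' ∉ c.sol,
        c.sketchCoverage (insert S' c.sol) ≤ c.sketchCoverage (insert S c.sol)) ∧
      c' = { c with sol := insert S c.sol } := by
  constructor
  · generalize hr : (3 : Fin 4) = r
    intro hs
    cases hs with
    | greedy _ S h1 h2 h3 => exact ⟨rfl, S, h1, h2, h3, rfl⟩
    | _ => exact absurd hr (by decide)
  · rintro ⟨rfl, S, h1, h2, h3, rfl⟩
    exact Step.greedy c S h1 h2 h3

theorem eq_of_reflTransGen_of_forall_not {α : Type*} {R : α → α → Prop} {a b : α}
    (h : Relation.ReflTransGen R a b) (ha : ∀ c, ¬ R a c) : b = a := by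
  rcases h.cases_head with rfl | ⟨c, hc, _⟩
  · rfl
  · exact absurd hc (ha c)

/-! ### Termination -/

/-- A bound on the number of steps that a machine can still make in a round. -/
noncomputable def remainingSteps (P : Params) (c : Memory F E) : ℕ := by
  classical exact c.inbox.card + (P.k - c.sol.card) + if c.outbox = 0 then 1 else 0

theorem remainingSteps_lt {r : Fin 4} {i : Machine E} {c c' : Memory F E}
    (hs : Step P r i c c') : remainingSteps P c' < remainingSteps P c := by
  classical
  cases hs with
  | report v c h1 h2 => simp [remainingSteps, h2]
  | select c v x d rest h1 h2 h3 =>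
    simp only [remainingSteps, h1, Multiset.card_cons, Multiset.cons_ne_zero, if_false]
    omega
  | send v c rest T h1 h2 h3 =>
    simp only [remainingSteps, h1, Multiset.card_cons]
    have : (if c.outbox + T.val.map (fun S => ((Machine.one : Machine E), Msg.edge S v)) = 0
        then 1 else 0) ≤ if c.outbox = 0 then 1 else 0 := by
      by_cases h : c.outbox = 0
      · rw [if_pos h]; split_ifs <;> omega
      · rw [if_neg h, if_neg fun h' => h (add_eq_zero.1 h').1]
    omega
  | greedy c S h1 h2 h3 =>
    simp only [remainingSteps, Finset.card_insert_of_notMem h2]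
    omega

/-- Every local computation can be continued until no step is possible. -/
theorem exists_halted (r : Fin 4) (i : Machine E) (c : Memory F E) :
    ∃ c', Relation.ReflTransGen (Step P r i) c c' ∧ ∀ c'', ¬ Step P r i c' c'' := by
  induction hN : remainingSteps P c using Nat.strong_induction_on generalizing c with
  | _ N ih =>
    by_cases h : ∃ c', Step P r i c c'
    · obtain ⟨c', hc'⟩ := h
      obtain ⟨c'', h1, h2⟩ := ih _ (hN ▸ remainingSteps_lt hc') c' rfl
      exact ⟨c'', h1.head hc', h2⟩
    · exact ⟨c, .refl, fun c'' hc'' => h ⟨c'', hc''⟩⟩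

theorem nonempty_execution [Fintype F] [Fintype E] [DecidableEq E] (P : Params)
    (A : F → Finset E) (h : E → unitInterval) : Nonempty (Execution P A h) := by
  choose fin h1 h2 using fun (r : Fin 4) (i : Machine E) (c : Memory F E) =>
    exists_halted (P := P) r i c
  let s0 : Machine E → Memory F E := initial A h
  let s1 : Machine E → Memory F E := deliver fun i => fin 0 i (s0 i)
  let s2 : Machine E → Memory F E := deliver fun i => fin 1 i (s1 i)
  let s3 : Machine E → Memory F E := deliver fun i => fin 2 i (s2 i)
  let s : Fin 4 → Machine E → Memory F E := ![s0, s1, s2, s3]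
  refine ⟨⟨s, fun r i => fin r i (s r i), rfl, ?_, fun r i => h1 r i _, fun r i => h2 r i _⟩⟩
  intro r
  fin_cases r <;> rfl

/-! ### The four rounds -/

/-- The message by which the machine of an element reports to machine one. -/
def reportMsg [Fintype F] [DecidableEq E] (A : F → Finset E) (h : E → unitInterval) (v : E) :
    Msg F E :=
  .report v (h v) (neighbours A v).card

/-- The elements whose machines report to machine one. -/
noncomputable def reported [Fintype E] (P : Params) (h : E → unitInterval) : Finset E :=
  sample h (2 * P.nTilde / P.m)

/-- The degree of an element in the sketch. -/
noncomputable def cappedDegree [Fintype F] [DecidableEq E] (P : Params) (A : F → Finset E)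
    (v : E) : ℕ :=
  min (neighbours A v).card P.maxDegree

theorem sum_ite_singleton {α β : Type*} [Fintype α] [DecidableEq α] (s : Finset α) (g : α → β) :
    (∑ v, if v ∈ s then ({g v} : Multiset β) else 0) = s.val.map g := by
  rw [Finset.sum_ite_mem, Finset.univ_inter, Finset.sum_eq_multiset_sum]
  have := Multiset.sum_map_singleton (s.val.map g)
  rwa [Multiset.map_map] at this

theorem sum_ite_multiset {α β : Type*} [Fintype α] [DecidableEq α] (s : Finset α)
    (g : α → Multiset β) : (∑ v, if v ∈ s then g v else 0) = ∑ v ∈ s, g v := by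
  rw [Finset.sum_ite_mem, Finset.univ_inter]

/-- The memory of machine one in the fourth round, when it has received the graph with neighbours
`B v`, `v ∈ X`, and chosen the sets in `T`. -/
def greedyMemory (X : Finset E) (B : E → Finset F) (t : ℕ) (T : Finset F) : Memory F E :=
  ⟨∑ v ∈ X, (B v).val.map fun S => .edge S v, 0, ∅, 0, t, T⟩

theorem sketchCoverage_greedyMemory (X : Finset E) (B : E → Finset F) (t : ℕ) (T T' : Finset F) :
    (greedyMemory X B t T).sketchCoverage T' = hits B X T' := by
  rw [Memory.sketchCoverage, hits, ← Set.ncard_coe_finset]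
  congr 1
  ext v
  simp only [greedyMemory, Multiset.mem_sum, Multiset.mem_map, Finset.coe_filter,
    Set.mem_ofPred_eq, Finset.mem_val, Msg.edge.injEq]
  constructor
  · rintro ⟨S, hS, u, hu, S', hS', rfl, rfl⟩
    exact ⟨hu, S', hS, hS'⟩
  · rintro ⟨hv, S, hS, hSv⟩
    exact ⟨S, hS, v, hv, S, hSv, rfl, rfl⟩

theorem greedyMemory_reachable {X : Finset E} {B : E → Finset F} {t : ℕ} {c : Memory F E}
    (hc : Relation.ReflTransGen (Step P 3 .one) (greedyMemory X B t ∅) c) :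
    ∃ T, T.card ≤ P.k ∧ GreedyBound B X T ∧ c = greedyMemory X B t T := by
  induction hc with
  | refl => exact ⟨∅, by simp, greedyBound_empty, rfl⟩
  | tail _ hs ih =>
    obtain ⟨T, hT, hg, rfl⟩ := ih
    obtain ⟨-, S, h1, h2, h3, rfl⟩ := step_three_iff.1 hs
    simp only [sketchCoverage_greedyMemory] at h3
    change T.card < P.k at h1
    change S ∉ T at h2
    exact ⟨insert S T, by rw [Finset.card_insert_of_notMem h2]; omega, hg.insert h2 h3, rfl⟩

theorem greedyMemory_halted [Fintype F] {X : Finset E} {B : E → Finset F} {t : ℕ} {T : Finset F}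
    (hk : P.k ≤ Fintype.card F) (hT : T.card ≤ P.k)
    (hh : ∀ c, ¬ Step P 3 .one (greedyMemory X B t T) c) : T.card = P.k := by
  by_contra hne
  have hlt : T.card < P.k := by omega
  have hne : (Tᶜ).Nonempty := by
    rw [← Finset.card_pos, Finset.card_compl]; omega
  obtain ⟨S, hS, hmax⟩ := Finset.exists_max_image _ (fun S => hits B X (insert S T)) hne
  refine hh _ (step_three_iff.2 ⟨rfl, S, hlt, Finset.mem_compl.1 hS, ?_, rfl⟩)
  intro S' hS'
  rw [sketchCoverage_greedyMemory, sketchCoverage_greedyMemory]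
  exact hmax S' (Finset.mem_compl.2 hS')

variable [Fintype F] [DecidableEq E] {A : F → Finset E} {h : E → unitInterval}

theorem send_reachable {v : E} {X : Finset E} {c : Memory F E}
    (hc : Relation.ReflTransGen (Step P 2 (.elem v))
      ⟨if v ∈ X then {.selected} else 0, 0, neighbours A v, h v, 0, ∅⟩ c) :
    c = ⟨if v ∈ X then {.selected} else 0, 0, neighbours A v, h v, 0, ∅⟩ ∨
      (v ∈ X ∧ ∃ T ⊆ neighbours A v, T.card = cappedDegree P A v ∧
        c = ⟨0, T.val.map fun S => (.one, .edge S v), neighbours A v, h v, 0, ∅⟩) := by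
  rcases hc.cases_head with rfl | ⟨c', h1, h2⟩
  · exact Or.inl rfl
  · obtain ⟨u, rest, T, hu, h3, h4, h5, rfl⟩ := step_two_iff.1 h1
    cases hu
    by_cases hv : v ∈ X
    · simp only [hv, if_true] at h3
      have hrest : rest = 0 := by
        have := congrArg Multiset.card h3
        simpa using this
      subst hrest
      refine Or.inr ⟨hv, T, h4, h5, ?_⟩
      have := eq_of_reflTransGen_of_forall_not h2 fun c'' hc'' => by
        obtain ⟨u', rest', T', -, h6, -⟩ := step_two_iff.1 hc''
        simp at h6
      simpa using this
    · simp [hv] at h3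

variable [Fintype E]

theorem initial_reachable {v : E} {c : Memory F E}
    (hc : Relation.ReflTransGen (Step P 0 (.elem v)) (initial A h (.elem v)) c) :
    c = initial A h (.elem v) ∨
      (v ∈ reported P h ∧ c = ⟨0, {(.one, reportMsg A h v)}, neighbours A v, h v, 0, ∅⟩) := by
  rcases hc.cases_head with rfl | ⟨c', h1, h2⟩
  · exact Or.inl rfl
  · obtain ⟨u, hu, h3, h4, rfl⟩ := step_zero_iff.1 h1
    cases hu
    refine Or.inr ⟨mem_sample.2 h3, ?_⟩
    refine eq_of_reflTransGen_of_forall_not h2 fun c'' hc'' => ?_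
    obtain ⟨u', -, -, h5, -⟩ := step_zero_iff.1 hc''
    simp at h5

/-- The memory of machine one in the second round, once the elements of `X` are selected. -/
noncomputable def selectMemory (P : Params) (A : F → Finset E) (h : E → unitInterval)
    (X : Finset E) : Memory F E :=
  ⟨(reported P h \ X).val.map (reportMsg A h), X.val.map fun v => (.elem v, .selected), ∅, 0,
    ∑ v ∈ X, cappedDegree P A v, ∅⟩

/-- The sets of selected elements that the second round can reach. -/
structure IsSelection (P : Params) (A : F → Finset E) (h : E → unitInterval) (X : Finset E) :
    Prop where
  subset : X ⊆ reported P h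
  /-- all other elements, reported or not, have hash values at least as large -/
  le_hash : ∀ u ∈ X, ∀ v ∉ X, h u ≤ h v
  /-- the last selected element overshoots `ñ` by at most `Δ` -/
  sum_le : ((∑ v ∈ X, cappedDegree P A v : ℕ) : ℝ) ≤ max P.nTilde 0 + P.maxDegree

/-- A remaining reported element of smallest hash value is minimal among all elements outside `X`,
since elements that have not reported have larger hash values. -/
theorem selectMemory_step {X : Finset E} (hX : IsSelection P A h X) {c : Memory F E}
    (hs : Step P 1 .one (selectMemory P A h X) c) :
    ∃ X', IsSelection P A h X' ∧ c = selectMemory P A h X' := by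
  obtain ⟨-, v, x, d, rest, h1, h2, h3, rfl⟩ := step_one_iff.1 hs
  simp only [selectMemory] at h1 h3 ⊢
  have hv : Msg.report v x d ∈ (reported P h \ X).val.map (reportMsg A h) := by
    rw [h1]; exact Multiset.mem_cons_self _ _
  obtain ⟨u, hu, huv⟩ := Multiset.mem_map.1 hv
  simp only [reportMsg, Msg.report.injEq] at huv
  obtain ⟨rfl, rfl, rfl⟩ := huv
  have hu' : u ∈ reported P h ∧ u ∉ X := Finset.mem_sdiff.1 hu
  have hval : (reported P h \ X).val = u ::ₘ (reported P h \ insert u X).val := by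
    rw [Finset.sdiff_insert, Finset.erase_val, Multiset.cons_erase hu]
  have hrest : rest = (reported P h \ insert u X).val.map (reportMsg A h) := by
    rw [hval, Multiset.map_cons] at h1
    exact ((Multiset.cons_inj_right _).1 h1).symm
  refine ⟨insert u X, ⟨Finset.insert_subset hu'.1 hX.subset, ?_, ?_⟩, ?_⟩
  · intro w hw v hv
    rw [Finset.mem_insert, not_or] at hv
    rcases Finset.mem_insert.1 hw with rfl | hw
    · by_cases hvr : v ∈ reported P h
      · have : reportMsg A h v ∈ rest := by
          rw [hrest]
          refine Multiset.mem_map_of_mem _ (Finset.mem_sdiff.2 ⟨hvr, ?_⟩)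
          rw [Finset.mem_insert, not_or]
          exact hv
        exact_mod_cast h2 _ _ _ this
      · have h4 := mem_sample.1 hu'.1
        rw [reported, mem_sample, not_le] at hvr
        exact_mod_cast h4.trans hvr.le
    · exact hX.le_hash w hw v hv.2
  · rw [Finset.sum_insert hu'.2]
    have h4 : cappedDegree P A u ≤ P.maxDegree := min_le_right _ _
    have h5 : (cappedDegree P A u : ℝ) ≤ P.maxDegree := by exact_mod_cast h4
    push_cast at h3 ⊢
    linarith [le_max_left P.nTilde 0]
  · simp only [Finset.sum_insert hu'.2, Finset.insert_val, Multiset.ndinsert_of_notMem hu'.2,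
      Multiset.map_cons, hrest, cappedDegree, add_comm]

theorem selectMemory_reachable {c : Memory F E}
    (hc : Relation.ReflTransGen (Step P 1 .one) (selectMemory P A h ∅) c) :
    ∃ X, IsSelection P A h X ∧ c = selectMemory P A h X := by
  induction hc with
  | refl =>
    exact ⟨∅, ⟨by simp, by simp,
      by simpa using add_nonneg (le_max_right _ _) (Nat.cast_nonneg _)⟩, rfl⟩
  | tail _ hs ih =>
    obtain ⟨X, hX, rfl⟩ := ih
    exact selectMemory_step hX hs

theorem selectMemory_halted {X : Finset E} (hX : IsSelection P A h X)
    (hh : ∀ c, ¬ Step P 1 .one (selectMemory P A h X) c) :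
    P.nTilde ≤ ((∑ v ∈ X, cappedDegree P A v : ℕ) : ℝ) ∨ X = reported P h := by
  by_contra! hcon
  have hne : (reported P h \ X).Nonempty := by
    rw [Finset.sdiff_nonempty]
    exact fun hsub => hcon.2 (hX.subset.antisymm hsub)
  obtain ⟨u, hu, hmin⟩ := Finset.exists_min_image _ (fun v => h v) hne
  refine hh _ (step_one_iff.2 ⟨rfl, u, h u, (neighbours A u).card,
    ((reported P h \ X).val.erase u).map (reportMsg A h), ?_, ?_, hcon.1, rfl⟩)
  · change (reported P h \ X).val.map (reportMsg A h) = reportMsg A h u ::ₘ _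
    rw [← Multiset.map_cons, Multiset.cons_erase hu]
  · intro v' x' d' hv'
    obtain ⟨w, hw, hwv⟩ := Multiset.mem_map.1 hv'
    simp only [reportMsg, Msg.report.injEq] at hwv
    obtain ⟨rfl, rfl, rfl⟩ := hwv
    exact_mod_cast hmin w (Multiset.mem_of_mem_erase hw)

namespace Execution

/-- What an execution computes, and the space it takes: `X` is the set of selected elements, and
`B v` are the neighbours of `v` in the graph on which the greedy algorithm runs. -/
theorem exists_selection (x : Execution P A h) (hk : P.k ≤ Fintype.card F) :
    ∃ (X : Finset E) (B : E → Finset F), IsSelection P A h X ∧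
      (P.nTilde ≤ ((∑ v ∈ X, cappedDegree P A v : ℕ) : ℝ) ∨ X = reported P h) ∧
      (∀ v ∈ X, B v ⊆ neighbours A v ∧ (B v).card = cappedDegree P A v) ∧
      GreedyBound B X x.output ∧ x.output.card = P.k ∧
      ∀ r i c, Relation.ReflTransGen (Step P r i) (x.start r i) c →
        c.words ≤ 3 * (reported P h).card + 2 * ∑ v ∈ X, cappedDegree P A v +
          4 * Fintype.card F + 6 := by
  have hnb : ∀ v, (neighbours A v).card ≤ Fintype.card F := fun v => Finset.card_le_univ _
  -- In the first round the machines of the reported elements, and no others, send a report.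
  have hs0 := x.start_zero
  have hone0 : ∀ c, Relation.ReflTransGen (Step P 0 .one) (x.start 0 .one) c →
      c = ⟨0, 0, ∅, 0, 0, ∅⟩ := by
    intro c hc
    rw [hs0] at hc
    refine eq_of_reflTransGen_of_forall_not hc fun c' hc' => ?_
    obtain ⟨v, hv, -⟩ := step_zero_iff.1 hc'
    cases hv
  have helem0 : ∀ v, x.final 0 (.elem v) =
      ⟨0, if v ∈ reported P h then {(.one, reportMsg A h v)} else 0, neighbours A v, h v, 0,
        ∅⟩ := by
    intro v
    have hc := x.computes 0 (.elem v)
    rw [hs0] at hc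
    rcases initial_reachable hc with hf | ⟨hv, hf⟩
    · have hv : v ∉ reported P h := by
        intro hv
        refine x.halts 0 (.elem v) _ (step_zero_iff.2 ⟨v, rfl, ?_, ?_, rfl⟩)
        · rw [hf]; exact mem_sample.1 hv
        · rw [hf]; rfl
      rw [hf, if_neg hv]; rfl
    · rw [hf, if_pos hv]
  have hs1 : x.start 1 = deliver (x.final 0) := x.start_succ 0
  have hone0' := hone0 _ (x.computes 0 .one)
  -- In the second round only machine one acts; it selects the set `X`.
  have hs1one : x.start 1 .one = selectMemory P A h ∅ := by
    rw [hs1, deliver, hone0']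
    simp only [helem0, sum_ite_singleton, selectMemory, zero_add]
    congr 1
    simp [Multiset.filter_map]
  have hs1elem : ∀ v, x.start 1 (.elem v) = ⟨0, 0, neighbours A v, h v, 0, ∅⟩ := by
    intro v
    rw [hs1, deliver, hone0']
    simp only [helem0, sum_ite_singleton, zero_add]
    congr 1
    simp [Multiset.filter_map]
  have helem1 : ∀ v c, Relation.ReflTransGen (Step P 1 (.elem v)) (x.start 1 (.elem v)) c →
      c = ⟨0, 0, neighbours A v, h v, 0, ∅⟩ := by
    intro v c hc
    rw [hs1elem] at hc
    refine eq_of_reflTransGen_of_forall_not hc fun c' hc' => ?_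
    obtain ⟨hv, -⟩ := step_one_iff.1 hc'
    cases hv
  have helem1' := fun v => helem1 v _ (x.computes 1 (.elem v))
  have hreach1 : ∀ c, Relation.ReflTransGen (Step P 1 .one) (x.start 1 .one) c →
      ∃ X, IsSelection P A h X ∧ c = selectMemory P A h X := by
    intro c hc
    rw [hs1one] at hc
    exact selectMemory_reachable hc
  obtain ⟨X, hX, hf1⟩ := hreach1 _ (x.computes 1 .one)
  have hhalt1 := selectMemory_halted hX (by rw [← hf1]; exact x.halts 1 .one)
  have hs2 : x.start 2 = deliver (x.final 1) := x.start_succ 1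
  -- In the third round only machines of selected elements act; they send the edges `B v`.
  have hs2one : x.start 2 .one = ⟨0, 0, ∅, 0, ∑ v ∈ X, cappedDegree P A v, ∅⟩ := by
    rw [hs2, deliver, hf1]
    simp only [helem1', selectMemory, Finset.sum_const_zero, add_zero]
    congr 1
    simp [Multiset.filter_map]
  have hs2elem : ∀ v, x.start 2 (.elem v) =
      ⟨if v ∈ X then {.selected} else 0, 0, neighbours A v, h v, 0, ∅⟩ := by
    intro v
    rw [hs2, deliver, hf1]
    simp only [helem1', selectMemory, Finset.sum_const_zero, add_zero]
    congr 1
    rw [Multiset.filter_map, Multiset.map_map]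
    simp only [Function.comp_def, Machine.elem.injEq, Multiset.filter_eq', Multiset.map_replicate]
    by_cases hv : v ∈ X
    · rw [if_pos hv, Multiset.count_eq_one_of_mem X.nodup hv]; rfl
    · rw [if_neg hv, Multiset.count_eq_zero_of_notMem hv]; rfl
  have hone2 : ∀ c, Relation.ReflTransGen (Step P 2 .one) (x.start 2 .one) c →
      c = ⟨0, 0, ∅, 0, ∑ v ∈ X, cappedDegree P A v, ∅⟩ := by
    intro c hc
    rw [hs2one] at hc
    refine eq_of_reflTransGen_of_forall_not hc fun c' hc' => ?_
    obtain ⟨v, -, -, hv, -⟩ := step_two_iff.1 hc'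
    cases hv
  have hone2' := hone2 _ (x.computes 2 .one)
  have hreach2 : ∀ v c, Relation.ReflTransGen (Step P 2 (.elem v)) (x.start 2 (.elem v)) c →
      c = ⟨if v ∈ X then {.selected} else 0, 0, neighbours A v, h v, 0, ∅⟩ ∨
      (v ∈ X ∧ ∃ T ⊆ neighbours A v, T.card = cappedDegree P A v ∧
        c = ⟨0, T.val.map fun S => (.one, .edge S v), neighbours A v, h v, 0, ∅⟩) := by
    intro v c hc
    rw [hs2elem] at hc
    exact send_reachable hc
  have hfin2 : ∀ v, ∃ T, (v ∈ X → T ⊆ neighbours A v ∧ T.card = cappedDegree P A v) ∧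
      x.final 2 (.elem v) = ⟨0, if v ∈ X then T.val.map fun S => (.one, .edge S v) else 0,
        neighbours A v, h v, 0, ∅⟩ := by
    intro v
    rcases hreach2 v _ (x.computes 2 (.elem v)) with hf | ⟨hv, T, hT, hTc, hf⟩
    · by_cases hv : v ∈ X
      · obtain ⟨T, hT, hTc⟩ := Finset.exists_subset_card_eq
          (min_le_left (neighbours A v).card P.maxDegree)
        exact absurd (step_two_iff.2 ⟨v, 0, T, rfl, by rw [hf, if_pos hv]; rfl,
          by rw [hf]; exact hT, by rw [hf]; exact hTc, rfl⟩) (x.halts 2 (.elem v) _)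
      · exact ⟨∅, fun hv' => absurd hv' hv, by rw [hf]; simp [hv]⟩
    · exact ⟨T, fun _ => ⟨hT, hTc⟩, by rw [hf, if_pos hv]⟩
  choose B hB hfin2 using hfin2
  have hs3 : x.start 3 = deliver (x.final 2) := x.start_succ 2
  -- In the fourth round only machine one acts, on the graph with neighbours `B v`, `v ∈ X`.
  have hmsgs : ∑ v, (x.final 2 (.elem v)).outbox =
      (∑ v ∈ X, (B v).val.map fun S => Msg.edge S v).map fun e => (.one, e) := by
    simp only [hfin2, sum_ite_multiset]
    have := map_sum (Multiset.mapAddMonoidHom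
      (fun e : Msg F E => ((Machine.one : Machine E), e)))
      (fun v => (B v).val.map fun S => Msg.edge S v) X
    simp only [Multiset.coe_mapAddMonoidHom, Multiset.map_map] at this
    exact this.symm
  have hs3one : x.start 3 .one = greedyMemory X B (∑ v ∈ X, cappedDegree P A v) ∅ := by
    rw [hs3, deliver, hmsgs, hone2', greedyMemory]
    congr 1
    simp [Multiset.filter_map]
  have hs3elem : ∀ v, x.start 3 (.elem v) = ⟨0, 0, neighbours A v, h v, 0, ∅⟩ := by
    intro v
    rw [hs3, deliver, hmsgs, hone2', hfin2]
    congr 1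
    simp [Multiset.filter_map]
  have helem3 : ∀ v c, Relation.ReflTransGen (Step P 3 (.elem v)) (x.start 3 (.elem v)) c →
      c = ⟨0, 0, neighbours A v, h v, 0, ∅⟩ := by
    intro v c hc
    rw [hs3elem] at hc
    refine eq_of_reflTransGen_of_forall_not hc fun c' hc' => ?_
    obtain ⟨hv, -⟩ := step_three_iff.1 hc'
    cases hv
  have hreach3 : ∀ c, Relation.ReflTransGen (Step P 3 .one) (x.start 3 .one) c →
      ∃ T, T.card ≤ P.k ∧ GreedyBound B X T ∧
        c = greedyMemory X B (∑ v ∈ X, cappedDegree P A v) T := by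
    intro c hc
    rw [hs3one] at hc
    exact greedyMemory_reachable hc
  obtain ⟨T, hT, hg, hf3⟩ := hreach3 _ (x.computes 3 .one)
  have hout : x.output = T := by rw [output, hf3]; rfl
  have hTk := greedyMemory_halted hk hT (by rw [← hf3]; exact x.halts 3 .one)
  refine ⟨X, B, hX, hhalt1, fun v hv => hB v hv, hout ▸ hg, hout ▸ hTk, ?_⟩
  intro r i c hc
  fin_cases r
  · cases i with
    | one =>
      rw [hone0 c hc]; simp [Memory.words]
    | elem v =>
      have hc' : Relation.ReflTransGen (Step P 0 (.elem v)) (x.start 0 (.elem v)) c := hc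
      rw [hs0] at hc'
      have := hnb v
      rcases initial_reachable hc' with rfl | ⟨-, rfl⟩
      · simp [Memory.words, initial]; omega
      · simp [Memory.words, Msg.words, reportMsg]; omega
  · cases i with
    | one =>
      obtain ⟨Y, hY, rfl⟩ := hreach1 c hc
      have h1 : (reported P h \ Y).card + Y.card = (reported P h).card :=
        Finset.card_sdiff_add_card_eq_card hY.subset
      simp only [Memory.words, selectMemory, Multiset.map_map, Function.comp_def, reportMsg,
        Msg.words, Multiset.map_const', Multiset.sum_replicate, Finset.card_val, smul_eq_mul,
        Finset.card_empty]
      omega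
    | elem v =>
      rw [helem1 v c hc]
      have := hnb v
      simp [Memory.words]; omega
  · cases i with
    | one =>
      rw [hone2 c hc]; simp [Memory.words]
    | elem v =>
      have := hnb v
      rcases hreach2 v c hc with rfl | ⟨-, T', hT', -, rfl⟩
      · by_cases hv : v ∈ X <;> simp [Memory.words, Msg.words, hv] <;> omega
      · have := Finset.card_le_card hT'
        simp [Memory.words, Multiset.map_map, Msg.words]
        omega
  · cases i with
    | one =>
      obtain ⟨T', hT', -, rfl⟩ := hreach3 c hc
      have h1 : ((∑ v ∈ X, (B v).val.map fun S => Msg.edge S v).map Msg.words).sum =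
          2 * ∑ v ∈ X, cappedDegree P A v := by
        have h2 := map_sum (Multiset.mapAddMonoidHom (Msg.words : Msg F E → ℕ))
          (fun v => (B v).val.map fun S => Msg.edge S v) X
        have h3 := map_sum (Multiset.sumAddMonoidHom : Multiset ℕ →+ ℕ)
          (fun v => ((B v).val.map fun S => Msg.edge S v).map (Msg.words : Msg F E → ℕ)) X
        simp only [Multiset.coe_mapAddMonoidHom, Multiset.coe_sumAddMonoidHom] at h2 h3
        rw [h2, h3, Finset.mul_sum]
        refine Finset.sum_congr rfl fun v hv => ?_
        rw [← (hB v hv).2]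
        simp [Multiset.map_map, Function.comp_def, Msg.words, mul_comm]
      simp only [Memory.words, greedyMemory, h1]
      simp
      omega
    | elem v =>
      rw [helem3 v c hc]
      have := hnb v
      simp [Memory.words]; omega

end Execution

end Algorithm

end KCover

/-! ### Estimates for the parameters -/

namespace KCover

namespace Params

/-- The range of parameters for which the sketch is analysed. -/
structure Admissible (P : Params) : Prop where
  three_le_n : 3 ≤ P.n
  two_le_m : 2 ≤ P.m
  one_le_k : 1 ≤ P.k
  k_le_n : P.k ≤ P.n
  eps_pos : 0 < P.eps
  eps_le : P.eps ≤ 1 / 20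
  conf_eq : P.conf = 10 * Real.log P.n

/-- `log_{1/(1-ε)} m`, which bounds the number of sampling rates `(1-ε)^j ≥ 1/m`. -/
noncomputable def levels (P : Params) : ℝ := Real.logb (1 / (1 - P.eps)) P.m

/-- The expected size of a sampled optimum from which on sampling preserves all coverages. -/
noncomputable def threshold (P : Params) : ℝ :=
  20 * P.k * Real.log P.levels * Real.log P.n / P.eps ^ 2

namespace Admissible

variable {P : Params} (hP : P.Admissible)
include hP

theorem one_le_log_n : 1 ≤ Real.log P.n := by
  have h3 : (3 : ℝ) ≤ P.n := by exact_mod_cast hP.three_le_n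
  rw [Real.le_log_iff_exp_le (by linarith)]
  linarith [Real.exp_one_lt_d9]

theorem one_le_log_inv : 1 ≤ Real.log (1 / P.eps) := by
  have h0 := hP.eps_pos
  rw [Real.le_log_iff_exp_le (by positivity), le_div_iff₀ h0]
  nlinarith [Real.exp_one_lt_d9, hP.eps_le, Real.exp_pos 1]

/-- This turns the factor `log (1/ε)` in `ñ`, and another one from `log log_{1/(1-ε)} m`, into a
single `1/ε`, by `log (1/ε) = 2 log √(1/ε) ≤ 2 √(1/ε)`. -/
theorem log_inv_sq_le : Real.log (1 / P.eps) ^ 2 ≤ 4 / P.eps := by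
  have h0 := hP.eps_pos
  have h1 := hP.one_le_log_inv
  have h2 : Real.log (1 / P.eps) = 2 * Real.log (Real.sqrt (1 / P.eps)) := by
    rw [Real.log_sqrt (by positivity)]; ring
  have h3 : Real.log (Real.sqrt (1 / P.eps)) ≤ Real.sqrt (1 / P.eps) :=
    Real.log_le_self (Real.sqrt_nonneg _)
  have h4 : Real.sqrt (1 / P.eps) ^ 2 = 1 / P.eps := Real.sq_sqrt (by positivity)
  have h5 : 0 ≤ Real.log (Real.sqrt (1 / P.eps)) := by linarith
  calc Real.log (1 / P.eps) ^ 2 = 4 * Real.log (Real.sqrt (1 / P.eps)) ^ 2 := by rw [h2]; ring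
    _ ≤ 4 * Real.sqrt (1 / P.eps) ^ 2 := by gcongr
    _ = 4 / P.eps := by rw [h4]; ring

theorem log_one_div_one_sub_bounds :
    P.eps ≤ Real.log (1 / (1 - P.eps)) ∧ Real.log (1 / (1 - P.eps)) ≤ 1 / 19 := by
  have h0 := hP.eps_pos
  have h1 := hP.eps_le
  have h2 : 0 < 1 - P.eps := by linarith
  constructor
  · have := Real.log_le_sub_one_of_pos h2
    rw [one_div, Real.log_inv]; linarith
  · refine (Real.log_le_sub_one_of_pos (by positivity)).trans ?_
    rw [sub_le_iff_le_add, div_le_iff₀ h2]; linarith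

theorem log_m_ge : 0.69 ≤ Real.log P.m := by
  have h2 : (2 : ℝ) ≤ P.m := by exact_mod_cast hP.two_le_m
  have := Real.log_le_log (by norm_num) h2
  linarith [Real.log_two_gt_d9]

theorem levels_bounds : 13 ≤ P.levels ∧ P.levels ≤ Real.log P.m / P.eps := by
  obtain ⟨h1, h2⟩ := hP.log_one_div_one_sub_bounds
  have h0 := hP.eps_pos
  have h3 := hP.log_m_ge
  have h4 : 0 < Real.log (1 / (1 - P.eps)) := by linarith
  rw [levels, Real.logb]
  constructor
  · rw [le_div_iff₀ h4]; linarith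
  · exact div_le_div_of_nonneg_left (by linarith) h0 h1

theorem one_le_log_levels : 1 ≤ Real.log P.levels := by
  have := hP.levels_bounds.1
  rw [Real.le_log_iff_exp_le (by linarith)]
  linarith [Real.exp_one_lt_d9]

theorem log_levels_le :
    Real.log P.levels ≤ Real.log (1 / P.eps) * (1 + Real.log (1 + Real.log P.m)) := by
  have h0 := hP.eps_pos
  have h1 := hP.levels_bounds
  have h2 := hP.log_m_ge
  have h3 := hP.one_le_log_inv
  have h4 : 0 ≤ Real.log (1 + Real.log P.m) := Real.log_nonneg (by linarith)
  have h5 : Real.log P.levels ≤ Real.log ((1 + Real.log P.m) * (1 / P.eps)) := by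
    apply Real.log_le_log (by linarith)
    refine h1.2.trans ?_
    rw [mul_one_div]
    gcongr
    linarith
  rw [Real.log_mul (by linarith) (by positivity)] at h5
  nlinarith

theorem nTilde_eq : P.nTilde = 240 * P.n * Real.log P.n ^ 2 * Real.log P.levels *
    Real.log (1 / P.eps) / ((1 - P.eps) * P.eps ^ 3) := by
  rw [nTilde, delta, hP.conf_eq, levels]; ring

theorem nTilde_ge :
    240 * P.n * Real.log P.n * Real.log P.levels * Real.log (1 / P.eps) / P.eps ^ 3 ≤
      P.nTilde := by
  have h0 := hP.eps_pos
  have h1 := hP.eps_le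
  have h2 := hP.one_le_log_n
  have h3 := hP.one_le_log_levels
  have h4 := hP.one_le_log_inv
  have h5 : (0 : ℝ) ≤ P.n := Nat.cast_nonneg _
  rw [hP.nTilde_eq]
  apply div_le_div₀ (by positivity)
  · have : Real.log P.n ≤ Real.log P.n ^ 2 := by nlinarith
    gcongr
  · have : 0 < 1 - P.eps := by linarith
    positivity
  · have : 0 < P.eps ^ 3 := by positivity
    nlinarith

theorem nTilde_le :
    P.nTilde ≤ 1920 / P.eps ^ 4 * P.n * Real.log P.n ^ 2 *
      (1 + Real.log (1 + Real.log P.m)) := by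
  have h0 := hP.eps_pos
  have h1 := hP.eps_le
  have h2 := hP.one_le_log_n
  have h4 := hP.one_le_log_inv
  have h5 : (0 : ℝ) ≤ P.n := Nat.cast_nonneg _
  have h6 := hP.log_levels_le
  have h7 := hP.log_inv_sq_le
  have h8 : 0 ≤ Real.log (1 + Real.log P.m) := Real.log_nonneg (by linarith [hP.log_m_ge])
  set W := 1 + Real.log (1 + Real.log P.m) with hW
  have hW0 : 0 ≤ W := by linarith
  have h9 : Real.log P.levels * Real.log (1 / P.eps) ≤ 4 / P.eps * W := by
    calc Real.log P.levels * Real.log (1 / P.eps)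
        ≤ (Real.log (1 / P.eps) * W) * Real.log (1 / P.eps) := by gcongr
      _ = Real.log (1 / P.eps) ^ 2 * W := by ring
      _ ≤ 4 / P.eps * W := by gcongr
  have h10 : 1 / ((1 - P.eps) * P.eps ^ 3) ≤ 2 / P.eps ^ 3 := by
    have : 0 < 1 - P.eps := by linarith
    rw [div_le_div_iff₀ (by positivity) (by positivity)]
    have : 0 < P.eps ^ 3 := by positivity
    nlinarith
  have h11 : 0 ≤ 1 / ((1 - P.eps) * P.eps ^ 3) := by
    have : 0 < 1 - P.eps := by linarith
    positivity
  calc P.nTilde = 240 * P.n * Real.log P.n ^ 2 * (Real.log P.levels * Real.log (1 / P.eps)) *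
        (1 / ((1 - P.eps) * P.eps ^ 3)) := by rw [hP.nTilde_eq]; ring
    _ ≤ 240 * P.n * Real.log P.n ^ 2 * (4 / P.eps * W) * (2 / P.eps ^ 3) := by gcongr
    _ = 1920 / P.eps ^ 4 * P.n * Real.log P.n ^ 2 * W := by field_simp; ring

theorem log_n_le_nTilde : 240 * Real.log P.n ≤ P.nTilde ∧ (240 * P.n : ℝ) ≤ P.nTilde := by
  have h0 := hP.eps_pos
  have h1 := hP.eps_le
  have h2 := hP.one_le_log_n
  have h3 := hP.one_le_log_levels
  have h4 := hP.one_le_log_inv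
  have h5 : (1 : ℝ) ≤ P.n := by exact_mod_cast hP.one_le_k.trans hP.k_le_n
  have h6 : 1 ≤ 1 / P.eps ^ 3 := by
    rw [le_div_iff₀ (by positivity), one_mul]
    exact pow_le_one₀ h0.le (by linarith)
  have h7 : 1 ≤ Real.log P.levels * Real.log (1 / P.eps) * (1 / P.eps ^ 3) :=
    one_le_mul_of_one_le_of_one_le (one_le_mul_of_one_le_of_one_le h3 h4) h6
  have h8 := hP.nTilde_ge
  have h9 : 240 * (P.n * Real.log P.n) *
      (Real.log P.levels * Real.log (1 / P.eps) * (1 / P.eps ^ 3)) ≤ P.nTilde := by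
    refine le_trans (le_of_eq ?_) h8; ring
  have h10 : 240 * (P.n * Real.log P.n) ≤ P.nTilde :=
    (le_mul_of_one_le_right (by positivity) h7).trans h9
  constructor <;> nlinarith

theorem cap_ge_one : 1 ≤ (P.n * Real.log (1 / P.eps) / (P.eps * P.k) : ℝ) := by
  have h0 := hP.eps_pos
  have h1 := hP.eps_le
  have h4 := hP.one_le_log_inv
  have h5 : (1 : ℝ) ≤ P.k := by exact_mod_cast hP.one_le_k
  have h6 : (P.k : ℝ) ≤ P.n := by exact_mod_cast hP.k_le_n
  rw [le_div_iff₀ (by positivity)]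
  nlinarith

theorem one_le_maxDegree : 1 ≤ P.maxDegree := by
  rw [maxDegree, Nat.one_le_floor_iff]; exact hP.cap_ge_one

theorem maxDegree_le : (P.maxDegree : ℝ) ≤ P.n * Real.log (1 / P.eps) / (P.eps * P.k) :=
  Nat.floor_le (by linarith [hP.cap_ge_one])

/-- Rounding down loses at most a factor `2`, because the rounded quantity is at least `1`. -/
theorem half_le_maxDegree :
    (P.n * Real.log (1 / P.eps) / (P.eps * P.k) : ℝ) / 2 ≤ P.maxDegree := by
  have h1 : (1 : ℝ) ≤ P.maxDegree := by exact_mod_cast hP.one_le_maxDegree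
  have h2 := Nat.lt_floor_add_one (P.n * Real.log (1 / P.eps) / (P.eps * P.k) : ℝ)
  change _ < (P.maxDegree : ℝ) + 1 at h2
  linarith

theorem maxDegree_le_nTilde : (P.maxDegree : ℝ) ≤ P.nTilde := by
  have h0 := hP.eps_pos
  have h1 := hP.eps_le
  have h2 := hP.one_le_log_n
  have h3 := hP.one_le_log_levels
  have h4 := hP.one_le_log_inv
  have h5 : (1 : ℝ) ≤ P.k := by exact_mod_cast hP.one_le_k
  have h6 : (0 : ℝ) ≤ P.n := Nat.cast_nonneg _
  refine hP.maxDegree_le.trans (le_trans ?_ hP.nTilde_ge)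
  have h7 : 1 ≤ Real.log P.n * Real.log P.levels := one_le_mul_of_one_le_of_one_le h2 h3
  have h8 : 0 ≤ P.n * Real.log (1 / P.eps) := by positivity
  apply div_le_div₀ (by positivity)
  · calc P.n * Real.log (1 / P.eps)
        ≤ P.n * Real.log (1 / P.eps) * (Real.log P.n * Real.log P.levels) :=
          le_mul_of_one_le_right h8 h7
      _ ≤ 240 * (P.n * Real.log (1 / P.eps) * (Real.log P.n * Real.log P.levels)) := by
          have : 0 ≤ P.n * Real.log (1 / P.eps) * (Real.log P.n * Real.log P.levels) := by
            positivity
          linarith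
      _ = _ := by ring
  · positivity
  · have : P.eps ^ 3 ≤ P.eps := by nlinarith [sq_nonneg P.eps]
    nlinarith

/-- A number of sets that suffices to cover nearly all elements of degree at least `Δ`. The value
is `⌈2εk⌉`, where `2` makes up for the rounding in `Δ`; if `εk < 1`, no degree exceeds `Δ`. -/
theorem exists_patch :
    ∃ r : ℕ, (r : ℝ) ≤ 3 * P.eps * P.k ∧ (P.n ≤ P.maxDegree ∨
      (P.maxDegree ≤ P.n ∧ (1 - (P.maxDegree : ℝ) / P.n) ^ r ≤ P.eps)) := by
  have h0 := hP.eps_pos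
  have h1 := hP.eps_le
  have h4 := hP.one_le_log_inv
  have h5 : (1 : ℝ) ≤ P.k := by exact_mod_cast hP.one_le_k
  have h6 : (0 : ℝ) < P.n := by exact_mod_cast hP.one_le_k.trans hP.k_le_n
  by_cases hn : P.n ≤ P.maxDegree
  · exact ⟨0, by simp; positivity, Or.inl hn⟩
  have hk : 1 ≤ P.eps * P.k := by
    by_contra! hlt
    refine hn (Nat.le_floor ?_)
    rw [le_div_iff₀ (by positivity)]
    have : P.n * (P.eps * P.k) ≤ P.n * 1 := by gcongr
    nlinarith
  refine ⟨⌈2 * P.eps * P.k⌉₊, ?_, Or.inr ⟨by omega, ?_⟩⟩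
  · have := Nat.ceil_lt_add_one (a := 2 * P.eps * P.k) (by positivity)
    linarith
  · have hle : (P.maxDegree : ℝ) / P.n ≤ 1 := by
      rw [div_le_one h6]; exact_mod_cast (by omega : P.maxDegree ≤ P.n)
    have hr : 2 * P.eps * P.k ≤ (⌈2 * P.eps * P.k⌉₊ : ℝ) := Nat.le_ceil _
    have hd : Real.log (1 / P.eps) / (2 * P.eps * P.k) ≤ P.maxDegree / P.n := by
      rw [le_div_iff₀ h6]
      refine le_trans (le_of_eq ?_) hP.half_le_maxDegree
      field_simp
    calc (1 - (P.maxDegree : ℝ) / P.n) ^ ⌈2 * P.eps * P.k⌉₊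
        ≤ Real.exp (-(P.maxDegree / P.n)) ^ ⌈2 * P.eps * P.k⌉₊ :=
          pow_le_pow_left₀ (by linarith) (Real.one_sub_le_exp_neg _) _
      _ = Real.exp (-(⌈2 * P.eps * P.k⌉₊ * (P.maxDegree / P.n))) := by
          rw [← Real.exp_nat_mul]; congr 1; ring
      _ ≤ Real.exp (-Real.log (1 / P.eps)) := by
          apply Real.exp_le_exp.2
          rw [neg_le_neg_iff]
          calc Real.log (1 / P.eps)
              = 2 * P.eps * P.k * (Real.log (1 / P.eps) / (2 * P.eps * P.k)) := by field_simp
            _ ≤ _ := by gcongr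
      _ = P.eps := by
          rw [one_div, Real.log_inv, neg_neg, Real.exp_log h0]

theorem threshold_ge_one : 1 ≤ P.threshold := by
  have h0 := hP.eps_pos
  have h1 := hP.eps_le
  have h2 := hP.one_le_log_n
  have h3 := hP.one_le_log_levels
  have h5 : (1 : ℝ) ≤ P.k := by exact_mod_cast hP.one_le_k
  have h7 : 1 ≤ P.k * Real.log P.levels * Real.log P.n :=
    one_le_mul_of_one_le_of_one_le (one_le_mul_of_one_le_of_one_le h5 h3) h2
  rw [threshold, le_div_iff₀ (by positivity)]
  nlinarith

theorem k_mul_nTilde_ge : 8 * P.n * P.threshold ≤ P.k * P.nTilde := by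
  have h0 := hP.eps_pos
  have h1 := hP.eps_le
  have h2 := hP.one_le_log_n
  have h3 := hP.one_le_log_levels
  have h4 := hP.one_le_log_inv
  have h5 : (0 : ℝ) ≤ P.k := Nat.cast_nonneg _
  have h6 : (0 : ℝ) ≤ P.n := Nat.cast_nonneg _
  refine le_trans ?_ (mul_le_mul_of_nonneg_left hP.nTilde_ge h5)
  have h7 : 1 ≤ Real.log (1 / P.eps) / P.eps := by rw [le_div_iff₀ h0]; linarith
  have h8 : 0 ≤ P.n * P.k * Real.log P.levels * Real.log P.n / P.eps ^ 2 := by positivity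
  calc 8 * P.n * P.threshold
      = 160 * (P.n * P.k * Real.log P.levels * Real.log P.n / P.eps ^ 2) := by
        rw [threshold]; ring
    _ ≤ 240 * (P.n * P.k * Real.log P.levels * Real.log P.n / P.eps ^ 2) := by linarith
    _ ≤ 240 * (P.n * P.k * Real.log P.levels * Real.log P.n / P.eps ^ 2) *
        (Real.log (1 / P.eps) / P.eps) := le_mul_of_one_le_right (by positivity) h7
    _ = _ := by field_simp

theorem maxDegree_mul_threshold_le : 8 * P.maxDegree * P.threshold ≤ P.nTilde := by
  have h0 := hP.eps_pos
  have h2 := hP.one_le_log_n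
  have h3 := hP.one_le_log_levels
  have h4 := hP.one_le_log_inv
  have h5 : (1 : ℝ) ≤ P.k := by exact_mod_cast hP.one_le_k
  have h6 : (0 : ℝ) ≤ P.n := Nat.cast_nonneg _
  have hQ := hP.threshold_ge_one
  have h8 : 0 ≤ P.n * Real.log P.n * Real.log P.levels * Real.log (1 / P.eps) / P.eps ^ 3 := by
    positivity
  calc 8 * P.maxDegree * P.threshold
      ≤ 8 * (P.n * Real.log (1 / P.eps) / (P.eps * P.k)) * P.threshold := by
        have := hP.maxDegree_le
        gcongr
    _ = 160 * (P.n * Real.log P.n * Real.log P.levels * Real.log (1 / P.eps) / P.eps ^ 3) := by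
        rw [threshold]; field_simp; ring
    _ ≤ 240 * (P.n * Real.log P.n * Real.log P.levels * Real.log (1 / P.eps) / P.eps ^ 3) := by
        linarith
    _ ≤ P.nTilde := le_trans (le_of_eq (by ring)) hP.nTilde_ge

/-- The failure probabilities of all sampling rates and all families of `k` sets add up to at most
`1/n`. -/
theorem union_bound {J : ℕ} (hJ : (J : ℝ) ≤ P.levels + 1) :
    J * ((P.n : ℝ) ^ P.k + 1) * Real.exp (-(P.eps ^ 2 * P.threshold / 4)) ≤ 1 / P.n := by
  have h0 := hP.eps_pos
  have h2 := hP.one_le_log_n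
  have h3 := hP.one_le_log_levels
  have h5 : (1 : ℝ) ≤ P.k := by exact_mod_cast hP.one_le_k
  have h6 : (3 : ℝ) ≤ P.n := by exact_mod_cast hP.three_le_n
  have hn : (0 : ℝ) < P.n := by linarith
  have hlev := hP.levels_bounds.1
  have e1 : P.eps ^ 2 * P.threshold / 4 = 5 * (P.k * Real.log P.levels * Real.log P.n) := by
    rw [threshold]; field_simp; ring
  have e2 : Real.exp (Real.log P.levels) = P.levels := Real.exp_log (by linarith)
  have e3 : Real.exp (P.k * Real.log P.n) = (P.n : ℝ) ^ P.k := by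
    rw [Real.exp_nat_mul, Real.exp_log hn]
  have e4 : Real.exp (2 * Real.log P.n) = (P.n : ℝ) ^ 2 := by
    rw [two_mul, Real.exp_add, Real.exp_log hn]; ring
  have e5 : (1 : ℝ) / P.n = Real.exp (-Real.log P.n) := by
    rw [Real.exp_neg, Real.exp_log hn, one_div]
  have hpow : (1 : ℝ) ≤ (P.n : ℝ) ^ P.k := one_le_pow₀ (by linarith)
  have hx : Real.log P.levels + P.k * Real.log P.n + 2 * Real.log P.n -
      5 * (P.k * Real.log P.levels * Real.log P.n) ≤ -Real.log P.n := by
    have a1 : 1 ≤ P.k * Real.log P.n := one_le_mul_of_one_le_of_one_le h5 h2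
    have a2 : Real.log P.levels ≤ P.k * Real.log P.levels * Real.log P.n := by nlinarith
    have a3 : P.k * Real.log P.n ≤ P.k * Real.log P.levels * Real.log P.n := by nlinarith
    have a4 : Real.log P.n ≤ P.k * Real.log P.n := by nlinarith
    linarith
  calc J * ((P.n : ℝ) ^ P.k + 1) * Real.exp (-(P.eps ^ 2 * P.threshold / 4))
      ≤ (2 * P.levels) * (2 * (P.n : ℝ) ^ P.k) *
          Real.exp (-(P.eps ^ 2 * P.threshold / 4)) := by
        gcongr <;> linarith
    _ ≤ P.levels * (P.n : ℝ) ^ P.k * (P.n : ℝ) ^ 2 *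
          Real.exp (-(P.eps ^ 2 * P.threshold / 4)) := by
        have : (4 : ℝ) ≤ (P.n : ℝ) ^ 2 := by nlinarith
        have hpos : 0 ≤ P.levels * (P.n : ℝ) ^ P.k := by positivity
        refine mul_le_mul_of_nonneg_right ?_ (Real.exp_pos _).le
        nlinarith
    _ = Real.exp (Real.log P.levels + P.k * Real.log P.n + 2 * Real.log P.n -
          5 * (P.k * Real.log P.levels * Real.log P.n)) := by
        rw [Real.exp_sub, Real.exp_add, Real.exp_add, e2, e3, e4, e1, Real.exp_neg,
          div_eq_mul_inv]
    _ ≤ 1 / P.n := by rw [e5]; exact Real.exp_le_exp.2 hx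

theorem exp_neg_nTilde_le :
    Real.exp (-(P.nTilde / 8)) + Real.exp (-(P.nTilde / 2)) ≤ 1 / P.n := by
  have h6 : (3 : ℝ) ≤ P.n := by exact_mod_cast hP.three_le_n
  have hn : (0 : ℝ) < P.n := by linarith
  have h1 := hP.log_n_le_nTilde.1
  have h2 := hP.one_le_log_n
  have h3 : Real.exp (-(P.nTilde / 8)) ≤ Real.exp (-(2 * Real.log P.n)) :=
    Real.exp_le_exp.2 (by linarith)
  have h4 : Real.exp (-(P.nTilde / 2)) ≤ Real.exp (-(2 * Real.log P.n)) :=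
    Real.exp_le_exp.2 (by linarith)
  have h5 : Real.exp (-(2 * Real.log P.n)) = 1 / P.n * (1 / P.n) := by
    rw [two_mul, neg_add, Real.exp_add, Real.exp_neg, Real.exp_log hn, one_div]
  have h7 : (1 : ℝ) / P.n ≤ 1 / 2 := one_div_le_one_div_of_le (by norm_num) (by linarith)
  have h8 : (0 : ℝ) < 1 / P.n := by positivity
  rw [h5] at h3 h4
  nlinarith

end Admissible

end Params

end KCover

/-! ### Quality of the sketch -/

namespace KCover

theorem sample_one {E : Type*} [Fintype E] (h : E → unitInterval) : sample h 1 = Finset.univ := by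
  ext v
  simpa [mem_sample] using (h v).2.2

theorem one_le_cappedDegree {F E : Type*} [Fintype F] [DecidableEq E] {P : Params}
    (hP : P.Admissible) {A : F → Finset E} (hA : ∀ v, ∃ S, v ∈ A S) (v : E) :
    1 ≤ cappedDegree P A v := by
  refine le_min ?_ hP.one_le_maxDegree
  obtain ⟨S, hS⟩ := hA v
  exact Finset.card_pos.2 ⟨S, by simpa [neighbours] using hS⟩

/-- If there are at least `ñ` edges and all degrees are at most `Δ`, then some `k` sets cover many
elements. -/
theorem exists_hits_ge_threshold {F E : Type*} [Fintype F] [DecidableEq F] {P : Params}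
    (hP : P.Admissible) (hn : P.n = Fintype.card F)
    {B : E → Finset F} {X : Finset E} (hB : ∀ v ∈ X, (B v).card ≤ P.maxDegree)
    (hD : P.nTilde ≤ ((∑ v ∈ X, (B v).card : ℕ) : ℝ)) :
    ∃ T : Finset F, T.card = P.k ∧ 4 * P.threshold ≤ hits B X T := by
  have hn0 : 0 < P.n := hP.one_le_k.trans hP.k_le_n
  have : Nonempty F := Fintype.card_pos_iff.1 (hn ▸ hn0)
  obtain ⟨T, hT, hor⟩ := exists_hits_ge hB rfl P.k
  obtain ⟨T', hTT', hT'⟩ := Finset.exists_superset_card_eq hT (hn ▸ hP.k_le_n)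
  refine ⟨T', hT', le_trans ?_ (Nat.cast_le.2 (hits_mono_right (B := B) (X := X) hTT'))⟩
  rcases hor with hor | hor
  · have h1 : (P.k : ℝ) * ((∑ v ∈ X, (B v).card : ℕ) : ℝ) ≤ 2 * P.n * hits B X T := by
      rw [hn]; exact_mod_cast hor
    have h2 := mul_le_mul_of_nonneg_left hD (Nat.cast_nonneg (α := ℝ) P.k)
    have h3 := hP.k_mul_nTilde_ge
    have h4 : (0 : ℝ) < 2 * P.n := by positivity
    refine le_of_mul_le_mul_left ?_ h4
    linarith
  · have h1 : ((∑ v ∈ X, (B v).card : ℕ) : ℝ) ≤ 2 * P.maxDegree * hits B X T := by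
      exact_mod_cast hor
    have h3 := hP.maxDegree_mul_threshold_le
    have h4 : (0 : ℝ) < 2 * P.maxDegree := by
      have : (1 : ℝ) ≤ P.maxDegree := by exact_mod_cast hP.one_le_maxDegree
      linarith
    refine le_of_mul_le_mul_left ?_ h4
    linarith

section Sketch

variable {F E : Type*} [DecidableEq F] [Fintype E] [DecidableEq E]

/-- The hash function `h` samples well at rate `p`, for an optimal family `T₀` of `k` sets: no
family of `k` sets is much overestimated, and `T₀` is not much underestimated. -/
def SamplesWell (N : E → Finset F) (k : ℕ) (T₀ : Finset F) (ε : ℝ) (h : E → unitInterval)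
    (p : ℝ) : Prop :=
  (∀ T : Finset F, T.card = k →
    (hits N (sample h p) T : ℝ) ≤
      p * hits N Finset.univ T + ε * p * hits N Finset.univ T₀) ∧
  p * hits N Finset.univ T₀ - ε * p * hits N Finset.univ T₀ ≤ (hits N (sample h p) T₀ : ℝ)

/-- A set of elements that is closed under passing to smaller hash values is comparable with every
sample. -/
theorem subset_sample_or_sample_subset {h : E → unitInterval} {X : Finset E}
    (hX : ∀ u ∈ X, ∀ v ∉ X, h u ≤ h v) (p : ℝ) : X ⊆ sample h p ∨ sample h p ⊆ X := by
  by_contra! hcon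
  obtain ⟨⟨u, hu, hup⟩, ⟨v, hvp, hv⟩⟩ :=
    (⟨Finset.not_subset.1 hcon.1, Finset.not_subset.1 hcon.2⟩ :
      (∃ u ∈ X, u ∉ sample h p) ∧ ∃ v ∈ sample h p, v ∉ X)
  rw [mem_sample] at hup hvp
  exact hup (le_trans (by exact_mod_cast hX u hu v hv) hvp)

/-- If `k` sets cover enough of `X` in the sketch, then an approximate solution `T` on the sketch is
one on the whole instance. The set `X` lies between the samples at rates `(1-ε)p` and `p`, for some
`p = (1-ε)^j` at which the sampled optimum is large. -/
theorem le_hits_of_samplesWell {N : E → Finset F} {k : ℕ} {T₀ T T₁ : Finset F} {ε Q : ℝ}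
    {h : E → unitInterval} {X : Finset E}
    (hopt : ∀ T' : Finset F, T'.card = k → hits N Finset.univ T' ≤ hits N Finset.univ T₀)
    (hε : 0 < ε) (hε' : ε ≤ 1 / 20) (hQ : 0 < Q)
    (hgood : ∀ j : ℕ, Q ≤ (1 - ε) ^ j * hits N Finset.univ T₀ →
      SamplesWell N k T₀ ε h ((1 - ε) ^ j))
    (hX : ∀ u ∈ X, ∀ v ∉ X, h u ≤ h v) (hT : T.card = k)
    (happrox : (1 - 1 / Real.exp 1 - 4 * ε) * hits N X T₀ ≤ hits N X T)
    (hT₁ : T₁.card = k) (hbig : 4 * Q ≤ hits N X T₁) :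
    (1 - 1 / Real.exp 1 - 7 * ε) * hits N Finset.univ T₀ ≤ hits N Finset.univ T := by
  set M : ℝ := ((hits N Finset.univ T₀ : ℕ) : ℝ) with hM
  have hM4 : 4 * Q ≤ M := hbig.trans (by
    rw [hM]; exact_mod_cast (hits_mono_left (Finset.subset_univ _) _).trans (hopt T₁ hT₁))
  have hMpos : 0 < M := by linarith
  obtain ⟨j, ⟨hj1, hj2⟩, hj3⟩ : ∃ j : ℕ,
      (Q ≤ (1 - ε) ^ j * M ∧ X ⊆ sample h ((1 - ε) ^ j)) ∧
      ¬ (Q ≤ (1 - ε) ^ (j + 1) * M ∧ X ⊆ sample h ((1 - ε) ^ (j + 1))) := by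
    by_contra! hcon
    have hall : ∀ j : ℕ, Q ≤ (1 - ε) ^ j * M ∧ X ⊆ sample h ((1 - ε) ^ j) := by
      intro j
      induction j with
      | zero => exact ⟨by rw [pow_zero]; linarith, by rw [pow_zero, sample_one]; simp⟩
      | succ j ih => exact hcon j ih
    obtain ⟨j, hj⟩ := exists_pow_lt_of_lt_one (div_pos hQ hMpos) (by linarith : 1 - ε < 1)
    rw [lt_div_iff₀ hMpos] at hj
    linarith [(hall j).1]
  set p := (1 - ε) ^ j with hp
  have hp0 : 0 < p := pow_pos (by linarith) _
  have hpq : (1 - ε) ^ (j + 1) = p * (1 - ε) := pow_succ _ _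
  have hpM : 0 < p * M := mul_pos hp0 hMpos
  have hsw := hgood j hj1
  have hle : ∀ T' : Finset F, (hits N X T' : ℝ) ≤ hits N (sample h p) T' := fun T' => by
    exact_mod_cast hits_mono_left hj2 T'
  -- Since `X` contains many elements covered by `T₁`, the rate `p` is not the last good one.
  have hQ' : Q ≤ (1 - ε) ^ (j + 1) * M := by
    have h1 := (hle T₁).trans (hsw.1 T₁ hT₁)
    have h2 : (hits N Finset.univ T₁ : ℝ) ≤ M := by rw [hM]; exact_mod_cast hopt T₁ hT₁
    rw [hpq]
    nlinarith [mul_le_mul_of_nonneg_left h2 hp0.le]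
  have hsub : sample h ((1 - ε) ^ (j + 1)) ⊆ X :=
    (subset_sample_or_sample_subset hX _).resolve_left fun h' => hj3 ⟨hQ', h'⟩
  have hlow := (hgood (j + 1) hQ').2
  have h3 : (hits N (sample h ((1 - ε) ^ (j + 1))) T₀ : ℝ) ≤ hits N X T₀ := by
    exact_mod_cast hits_mono_left hsub T₀
  rw [← hM, hpq] at hlow
  rw [hpq] at h3
  have h4 : (1 - ε) ^ 2 * (p * M) ≤ hits N X T₀ := by nlinarith
  have h5 := (happrox.trans (hle T)).trans (hsw.1 T hT)
  rw [← hM] at h5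
  have he : (1 : ℝ) / Real.exp 1 ≤ 1 / 2 := by
    apply one_div_le_one_div_of_le (by norm_num)
    linarith [Real.add_one_le_exp (1 : ℝ)]
  have he0 : (0 : ℝ) < 1 / Real.exp 1 := by positivity
  have h6 := mul_le_mul_of_nonneg_left h4 (by linarith : 0 ≤ 1 - 1 / Real.exp 1 - 4 * ε)
  have h7 : (1 - 1 / Real.exp 1 - 6 * ε) * (p * M) ≤
      (1 - 1 / Real.exp 1 - 4 * ε) * ((1 - ε) ^ 2 * (p * M)) := by
    rw [← mul_assoc (1 - 1 / Real.exp 1 - 4 * ε)]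
    refine mul_le_mul_of_nonneg_right ?_ hpM.le
    nlinarith [mul_pos hε he0, mul_pos (mul_pos hε hε) hε]
  refine le_of_mul_le_mul_left ?_ hp0
  linarith

theorem volume_biUnion_le {Ω ι : Type*} [MeasureSpace Ω] (s : Finset ι) (S : ι → Set Ω) {c : ℝ}
    (hS : ∀ i ∈ s, (volume : Measure Ω) (S i) ≤ ENNReal.ofReal c) :
    (volume : Measure Ω) (⋃ i ∈ s, S i) ≤ ENNReal.ofReal (s.card * c) := by
  refine (measure_biUnion_finset_le s S).trans ((Finset.sum_le_card_nsmul _ _ _ hS).trans ?_)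
  rw [nsmul_eq_mul, ENNReal.ofReal_mul (Nat.cast_nonneg _), ENNReal.ofReal_natCast]

/-- With probability at least `1 - J (n^k + 1) e^{-ε²Q/4}`, the hash function samples well at all
rates `(1-ε)^j` at which the sampled optimum is expected to be at least `Q`. -/
theorem volume_not_samplesWell_le [Fintype F] {N : E → Finset F} {k J : ℕ} {T₀ : Finset F}
    {ε Q : ℝ}
    (hopt : ∀ T' : Finset F, T'.card = k → hits N Finset.univ T' ≤ hits N Finset.univ T₀)
    (hε : 0 < ε) (hε' : ε ≤ 1 / 20)
    (hJ : ∀ j : ℕ, Q ≤ (1 - ε) ^ j * hits N Finset.univ T₀ → j < J) :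
    (volume : Measure (E → unitInterval))
      {h | ¬ ∀ j : ℕ, Q ≤ (1 - ε) ^ j * hits N Finset.univ T₀ →
        SamplesWell N k T₀ ε h ((1 - ε) ^ j)} ≤
      ENNReal.ofReal (J * ((Fintype.card F : ℝ) ^ k + 1) * Real.exp (-(ε ^ 2 * Q / 4))) := by
  set M : ℝ := ((hits N Finset.univ T₀ : ℕ) : ℝ) with hM
  set c := Real.exp (-(ε ^ 2 * Q / 4)) with hc
  have hp0 : ∀ j : ℕ, (0 : ℝ) ≤ (1 - ε) ^ j := fun j => pow_nonneg (by linarith) _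
  have hp1 : ∀ j : ℕ, (1 - ε : ℝ) ^ j ≤ 1 := fun j => pow_le_one₀ (by linarith) (by linarith)
  set I := (Finset.range J).filter fun j => Q ≤ (1 - ε) ^ j * M with hI
  have hexp : ∀ j ∈ I, ENNReal.ofReal (Real.exp (-(ε ^ 2 * ((1 - ε) ^ j * M) / 4))) ≤
      ENNReal.ofReal c := by
    intro j hj
    have hj' := (Finset.mem_filter.1 hj).2
    apply ENNReal.ofReal_le_ofReal
    apply Real.exp_le_exp.2
    have := mul_le_mul_of_nonneg_left hj' (sq_nonneg ε)
    linarith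
  let S : ℕ × Option (Finset F) → Set (E → unitInterval) := fun jT => match jT.2 with
    | some T => {h | (1 - ε) ^ jT.1 * hits N Finset.univ T + ε * (1 - ε) ^ jT.1 * M ≤
        hits N (sample h ((1 - ε) ^ jT.1)) T}
    | none => {h | (hits N (sample h ((1 - ε) ^ jT.1)) T₀ : ℝ) ≤
        (1 - ε) ^ jT.1 * M - ε * (1 - ε) ^ jT.1 * M}
  set s := I ×ˢ (Finset.powersetCard k (Finset.univ : Finset F)).insertNone with hs
  have hS : ∀ i ∈ s, (volume : Measure (E → unitInterval)) (S i) ≤ ENNReal.ofReal c := by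
    rintro ⟨j, T⟩ hi
    obtain ⟨hj, hT⟩ := Finset.mem_product.1 hi
    cases T with
    | some T =>
      have hT' : T.card = k :=
        (Finset.mem_powersetCard.1 (Finset.some_mem_insertNone.1 hT)).2
      exact (volume_hits_sample_gt_le N T (hp0 j) (hp1 j) hε.le (by linarith)
        (by rw [hM]; exact_mod_cast hopt T hT')).trans (hexp j hj)
    | none =>
      exact (volume_hits_sample_lt_le N T₀ (hp0 j) (hp1 j) hε.le (by linarith)
        hM.ge).trans (hexp j hj)
  have hcard : (s.card : ℝ) ≤ J * ((Fintype.card F : ℝ) ^ k + 1) := by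
    have h1 : I.card ≤ J := (Finset.card_filter_le _ _).trans (by simp)
    have h2 : (Fintype.card F).choose k ≤ Fintype.card F ^ k := Nat.choose_le_pow _ _
    have h3 : s.card ≤ J * (Fintype.card F ^ k + 1) := by
      rw [hs, Finset.card_product, Finset.card_insertNone, Finset.card_powersetCard,
        Finset.card_univ]
      gcongr
    exact_mod_cast h3
  refine le_trans (measure_mono ?_) ((volume_biUnion_le s S hS).trans
    (ENNReal.ofReal_le_ofReal (mul_le_mul_of_nonneg_right hcard (Real.exp_pos _).le)))
  intro h hh
  rw [Set.mem_ofPred_eq] at hh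
  push Not at hh
  obtain ⟨j, hjQ, hj⟩ := hh
  have hjI : j ∈ I := Finset.mem_filter.2 ⟨Finset.mem_range.2 (hJ j hjQ), hjQ⟩
  simp only [Set.mem_iUnion]
  rw [SamplesWell, not_and_or] at hj
  rcases hj with hj | hj
  · push Not at hj
    obtain ⟨T, hT, hlt⟩ := hj
    exact ⟨(j, some T), Finset.mem_product.2 ⟨hjI, Finset.some_mem_insertNone.2
      (Finset.mem_powersetCard.2 ⟨Finset.subset_univ _, hT⟩)⟩, hlt.le⟩
  · exact ⟨(j, none), Finset.mem_product.2 ⟨hjI, Finset.none_mem_insertNone⟩, (not_le.1 hj).le⟩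

end Sketch

/-! ### The number of reported elements -/

section Analysis

variable {F E : Type*} [Fintype F] [Fintype E] [DecidableEq E]

/-- The number of reported elements is as expected: at least `ñ`, unless all are reported, and at
most `4ñ`. -/
def ReportsWell (P : Params) (h : E → unitInterval) : Prop :=
  (reported P h = Finset.univ ∨ P.nTilde ≤ (reported P h).card) ∧
    ((reported P h).card : ℝ) ≤ 4 * P.nTilde

theorem volume_not_reportsWell_le {P : Params} (hm : P.m = Fintype.card E) (hm0 : 0 < P.m)
    (hn : 0 ≤ P.nTilde) :
    (volume : Measure (E → unitInterval)) {h | ¬ ReportsWell P h} ≤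
      ENNReal.ofReal (Real.exp (-(P.nTilde / 8)) + Real.exp (-(P.nTilde / 2))) := by
  have hm' : (0 : ℝ) < P.m := by exact_mod_cast hm0
  by_cases hall : 1 ≤ 2 * P.nTilde / P.m
  · have hgood : ∀ h : E → unitInterval, ReportsWell P h := by
      intro h
      have h1 : reported P h = Finset.univ := by
        ext v
        simpa [reported, mem_sample] using (h v).2.2.trans hall
      refine ⟨Or.inl h1, ?_⟩
      rw [h1, Finset.card_univ, ← hm]
      rw [le_div_iff₀ hm'] at hall
      linarith
    simp [hgood]
  · have hp1 : 2 * P.nTilde / P.m ≤ 1 := (not_le.1 hall).le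
    have hp0 : 0 ≤ 2 * P.nTilde / P.m := by positivity
    have hmean : 2 * P.nTilde / P.m * ((Finset.univ : Finset E).card : ℝ) = 2 * P.nTilde := by
      rw [Finset.card_univ, ← hm]; field_simp
    have h1 := chernoff (Finset.univ : Finset E) (s := -(1 / 4)) (-(P.nTilde / 4)) hp0 hp1
      (by rw [abs_neg, abs_of_pos] <;> norm_num)
    have h2 := chernoff (Finset.univ : Finset E) (s := 1 / 2) (2 * P.nTilde) hp0 hp1
      (by rw [abs_of_pos] <;> norm_num)
    rw [hmean] at h1 h2
    have e1 : 2 * P.nTilde * (-(1 / 4) + (-(1 / 4)) ^ 2) - -(P.nTilde / 4) = -(P.nTilde / 8) := by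
      ring
    have e2 : 2 * P.nTilde * (1 / 2 + (1 / 2) ^ 2) - 2 * P.nTilde = -(P.nTilde / 2) := by ring
    rw [e1] at h1
    rw [e2] at h2
    rw [ENNReal.ofReal_add (Real.exp_pos _).le (Real.exp_pos _).le]
    refine le_trans (measure_mono ?_) ((measure_union_le _ _).trans (add_le_add h1 h2))
    intro h hh
    rw [Set.mem_ofPred_eq, ReportsWell, not_and_or, not_or] at hh
    simp only [Set.mem_union, Set.mem_ofPred_eq, Finset.inter_univ]
    change _ ≤ _ * ((reported P h).card : ℝ) ∨ _ ≤ _ * ((reported P h).card : ℝ)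
    rcases hh with ⟨-, hh⟩ | hh
    · left; linarith
    · right; linarith

/-- Unless all elements are selected, the selected ones have at least `ñ` edges in the sketch. -/
theorem eq_univ_or_nTilde_le {P : Params} (hP : P.Admissible) {A : F → Finset E}
    (hA : ∀ v, ∃ S, v ∈ A S) {h : E → unitInterval} (hrep : ReportsWell P h) {X : Finset E}
    (hX : P.nTilde ≤ ((∑ v ∈ X, cappedDegree P A v : ℕ) : ℝ) ∨ X = reported P h) :
    X = Finset.univ ∨ P.nTilde ≤ ((∑ v ∈ X, cappedDegree P A v : ℕ) : ℝ) := by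
  rcases hX with hX | rfl
  · exact Or.inr hX
  · refine hrep.1.imp_right fun hle => hle.trans ?_
    have : (reported P h).card • 1 ≤ ∑ v ∈ reported P h, cappedDegree P A v :=
      Finset.card_nsmul_le_sum _ _ _ fun v _ => one_le_cappedDegree hP hA v
    rw [smul_eq_mul, mul_one] at this
    exact_mod_cast this

/-! ### Correctness and space of an execution -/

variable [DecidableEq F]

namespace Execution

variable {P : Params} {A : F → Finset E} {h : E → unitInterval}

/-- Every execution succeeds for a hash function with the two good properties. -/
theorem correct (x : Execution P A h) (hP : P.Admissible) (hn : P.n = Fintype.card F)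
    (hA : ∀ v, ∃ S, v ∈ A S) (hrep : ReportsWell P h) {T₀ : Finset F} (hT₀ : T₀.card = P.k)
    (hopt : ∀ T' : Finset F, T'.card = P.k →
      hits (neighbours A) Finset.univ T' ≤ hits (neighbours A) Finset.univ T₀)
    (hgood : ∀ j : ℕ, P.threshold ≤ (1 - P.eps) ^ j * hits (neighbours A) Finset.univ T₀ →
      SamplesWell (neighbours A) P.k T₀ P.eps h ((1 - P.eps) ^ j)) :
    IsApproxSolution A P.k (1 - 1 / Real.exp 1 - 7 * P.eps) x.output ∧
      x.SpaceAtMost (26 * P.nTilde) := by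
  obtain ⟨X, B, hX, hend, hB, hgreedy, hcard, hspace⟩ := x.exists_selection (hn ▸ hP.k_le_n)
  have h0 := hP.eps_pos
  have hε := hP.eps_le
  have hn1 := hP.log_n_le_nTilde.2
  have hn3 : (3 : ℝ) ≤ P.n := by exact_mod_cast hP.three_le_n
  constructor
  · obtain ⟨r, hr, hr'⟩ := hP.exists_patch
    have hcap : (1 - 1 / Real.exp 1 - 4 * P.eps) * hits (neighbours A) X T₀ ≤
        hits (neighbours A) X x.output := by
      refine (hgreedy.capped (by rw [hcard]; exact hP.one_le_k) (hT₀.trans hcard.symm)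
        (fun v hv => (hB v hv).1) (fun v hv => (hB v hv).2) h0 hε
        (by rw [hcard]; exact hr) (hn ▸ hr')).trans ?_
      exact_mod_cast hits_mono_graph (fun v hv => (hB v hv).1) _
    have hmain : (1 - 1 / Real.exp 1 - 7 * P.eps) * hits (neighbours A) Finset.univ T₀ ≤
        hits (neighbours A) Finset.univ x.output := by
      rcases eq_univ_or_nTilde_le hP hA hrep hend with rfl | hD
      · refine le_trans (mul_le_mul_of_nonneg_right ?_ (Nat.cast_nonneg _)) hcap
        linarith
      · have hsum : ∑ v ∈ X, cappedDegree P A v = ∑ v ∈ X, (B v).card :=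
          Finset.sum_congr rfl fun v hv => (hB v hv).2.symm
        rw [hsum] at hD
        obtain ⟨T₁, hT₁, hbig⟩ := exists_hits_ge_threshold hP hn
          (fun v hv => (hB v hv).2.trans_le (min_le_right _ _)) hD
        refine le_hits_of_samplesWell hopt h0 hε (by linarith [hP.threshold_ge_one]) hgood
          hX.le_hash hcard hcap hT₁ (hbig.trans ?_)
        exact_mod_cast hits_mono_graph (fun v hv => (hB v hv).1) _
    refine ⟨hcard, fun T' hT' => ?_⟩
    rw [coverage_eq_hits, coverage_eq_hits]
    refine le_trans (mul_le_mul_of_nonneg_left ?_ ?_) hmain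
    · exact_mod_cast hopt T' hT'
    · have : (1 : ℝ) / Real.exp 1 ≤ 1 / 2 := by
        apply one_div_le_one_div_of_le (by norm_num)
        linarith [Real.add_one_le_exp (1 : ℝ)]
      linarith
  · intro r i c hc
    have h1 : (c.words : ℝ) ≤ 3 * (reported P h).card +
        2 * ((∑ v ∈ X, cappedDegree P A v : ℕ) : ℝ) + 4 * P.n + 6 := by
      rw [hn]; exact_mod_cast hspace r i c hc
    have h2 := hX.sum_le
    rw [max_eq_left (by linarith)] at h2
    linarith [hrep.2, hP.maxDegree_le_nTilde]

end Execution

/-- The algorithm fails with probability at most `2/n`. -/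
theorem volume_failure_le {P : Params} (hP : P.Admissible) {A : F → Finset E}
    (hn : P.n = Fintype.card F) (hm : P.m = Fintype.card E) (hA : ∀ v, ∃ S, v ∈ A S) :
    (volume : Measure (E → unitInterval))
      {h | ∃ x : Execution P A h,
        ¬ (IsApproxSolution A P.k (1 - 1 / Real.exp 1 - 7 * P.eps) x.output ∧
          x.SpaceAtMost (26 * P.nTilde))} ≤ ENNReal.ofReal (2 / P.n) := by
  have h0 := hP.eps_pos
  have hε := hP.eps_le
  have hne : (Finset.powersetCard P.k (Finset.univ : Finset F)).Nonempty :=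
    Finset.powersetCard_nonempty.2 (by rw [Finset.card_univ, ← hn]; exact hP.k_le_n)
  obtain ⟨T₀, hT₀, hmax⟩ := Finset.exists_max_image _
    (fun T => hits (neighbours A) Finset.univ T) hne
  have hT₀ := (Finset.mem_powersetCard.1 hT₀).2
  have hopt : ∀ T' : Finset F, T'.card = P.k →
      hits (neighbours A) Finset.univ T' ≤ hits (neighbours A) Finset.univ T₀ := fun T' hT' =>
    hmax T' (Finset.mem_powersetCard.2 ⟨Finset.subset_univ _, hT'⟩)
  have hlev := hP.levels_bounds.1
  -- A rate at which the sampled optimum is expected to be at least `1` is at least `1/m`.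
  have hJ : ∀ j : ℕ, P.threshold ≤ (1 - P.eps) ^ j * hits (neighbours A) Finset.univ T₀ →
      j < ⌊P.levels⌋₊ + 1 := by
    intro j hj
    have h1 : (hits (neighbours A) Finset.univ T₀ : ℝ) ≤ P.m := by
      rw [hm]; exact Nat.cast_le.2 (hits_le_card _)
    have h2 : 0 < (1 - P.eps) ^ j := pow_pos (by linarith) _
    have h3 : 1 ≤ (1 - P.eps) ^ j * P.m :=
      hP.threshold_ge_one.trans (hj.trans (mul_le_mul_of_nonneg_left h1 h2.le))
    rw [Nat.lt_add_one_iff]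
    refine Nat.le_floor ?_
    have h4 : 1 < 1 / (1 - P.eps) := by
      rw [lt_div_iff₀ (by linarith)]; linarith
    have h5 : (0 : ℝ) < P.m := by exact_mod_cast (by have := hP.two_le_m; omega : 0 < P.m)
    rw [Params.levels, Real.le_logb_iff_rpow_le h4 h5, Real.rpow_natCast, one_div, inv_pow,
      inv_le_iff_one_le_mul₀' h2]
    exact h3
  have hbad1 := volume_not_samplesWell_le hopt h0 hε hJ
  have hbad2 := volume_not_reportsWell_le hm (by have := hP.two_le_m; omega)
    (by linarith [hP.log_n_le_nTilde.1, hP.one_le_log_n])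
  have hub := hP.union_bound (J := ⌊P.levels⌋₊ + 1) (by
    push_cast
    linarith [Nat.floor_le (by linarith : 0 ≤ P.levels)])
  rw [hn] at hub
  have htwo : (2 : ℝ) / P.n = 1 / P.n + 1 / P.n := by ring
  rw [htwo, ENNReal.ofReal_add (by positivity) (by positivity)]
  refine le_trans (measure_mono ?_) ((measure_union_le _ _).trans (add_le_add
    (hbad1.trans (ENNReal.ofReal_le_ofReal (by rw [hn]; exact hub)))
    (hbad2.trans (ENNReal.ofReal_le_ofReal hP.exp_neg_nTilde_le))))
  rintro h ⟨x, hx⟩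
  by_contra hcon
  rw [Set.mem_union, not_or, Set.mem_ofPred_eq, Set.mem_ofPred_eq, not_not, not_not] at hcon
  exact hx (x.correct hP hn hA hcon.2 hT₀ hopt hcon.1)

end Analysis

end KCover

theorem mainTheorem1 :
    ∃ a b K : ℝ, 0 < a ∧ a < 1 ∧ 0 < b ∧ 0 < K ∧
      ∀ (F : Type*) (E : Type*) [Fintype F] [DecidableEq F] [Fintype E] [DecidableEq E]
        (A : F → Finset E) (n m k : ℕ) (ε : ℝ),
        n = Fintype.card F → m = Fintype.card E → 2 ≤ m →
        (∀ v : E, ∃ S : F, v ∈ A S) →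
        1 ≤ k → k ≤ n → 0 < ε → ε ≤ 1 →
        (∀ h : E → unitInterval,
          Nonempty (KCover.Execution ⟨n, m, k, a * ε, b * Real.log n⟩ A h)) ∧
        (volume : Measure (E → unitInterval))
          {h | ∃ x : KCover.Execution ⟨n, m, k, a * ε, b * Real.log n⟩ A h,
            ¬ (KCover.IsApproxSolution A k (1 - 1 / Real.exp 1 - ε) x.output ∧
              x.SpaceAtMost
                (K / ε ^ 4 * n * Real.log n ^ 2 * (1 + Real.log (1 + Real.log m))))}
          ≤ ENNReal.ofReal (2 / n) := by
  -- The approximation loses `7aε ≤ ε`, and `a = 1/20` also makes `log log_{1/(1-aε)} m ≥ 1`. With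
  -- `b = 10`, the `24b = 240` in `ñ` exceeds the `160` that the threshold on the optimum needs. The
  -- space is at most `26ñ`, and `ñ` has a factor `1920 / (aε)^4`.
  refine ⟨1 / 20, 10, 26 * 1920 * 20 ^ 4, by norm_num, by norm_num, by norm_num, by norm_num, ?_⟩
  intro F E _ _ _ _ A n m k ε hn hm hm2 hA hk hkn hε hε1
  refine ⟨fun h => KCover.nonempty_execution _ A h, ?_⟩
  by_cases hn3 : 3 ≤ n
  · have hP : KCover.Params.Admissible ⟨n, m, k, 1 / 20 * ε, 10 * Real.log n⟩ :=
      ⟨hn3, hm2, hk, hkn, by simp; exact hε, by simp; linarith, rfl⟩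
    refine le_trans (measure_mono ?_) (KCover.volume_failure_le hP hn hm hA)
    rintro h ⟨x, hx⟩
    refine ⟨x, fun ⟨⟨hc, hapx⟩, hspace⟩ => hx ⟨⟨hc, fun T' hT' => ?_⟩, fun r i c hcr => ?_⟩⟩
    · refine le_trans (mul_le_mul_of_nonneg_right ?_ (Nat.cast_nonneg _)) (hapx T' hT')
      change _ ≤ 1 - 1 / Real.exp 1 - 7 * (1 / 20 * ε)
      linarith
    · refine (hspace r i c hcr).trans ?_
      have h1 := hP.nTilde_le
      refine (mul_le_mul_of_nonneg_left h1 (by norm_num)).trans (le_of_eq ?_)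
      change 26 * (1920 / (1 / 20 * ε) ^ 4 * n * Real.log n ^ 2 *
        (1 + Real.log (1 + Real.log m))) = _
      field_simp
  · -- For `n ≤ 2` the bound on the probability is trivial.
    refine prob_le_one.trans ?_
    rw [← ENNReal.ofReal_one]
    apply ENNReal.ofReal_le_ofReal
    have h1 : (1 : ℝ) ≤ n := by exact_mod_cast hk.trans hkn
    have h2 : (n : ℝ) ≤ 2 := by exact_mod_cast (by omega : n ≤ 2)
    rw [le_div_iff₀ (by linarith)]
    linarith
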